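/- **Theorem 3 (control retrial policy).** Consider a single server retrial queue in which external customers arrive according to a Poisson process of rate $\lambda>0$; an external customer who finds the server busy joins the orbit. At the end of each service a single retrial time starts; if it finishes before the next external arrival and the orbit is non-empty, one customer of the orbit enters service, otherwise the next external customer does. For $n\in\mathbb Z$ let $\sigma_n\ge 0$ be the duration of the service in the $n$-th cycle, $r_n\ge 0$ the retrial time and $\gamma_n$ the residual external arrival time at the beginning of the cycle (the end of the previous service), and $N_n(\cdot)$ the process counting the external arrivals during that service. Assume that $(\sigma_n)$ is stationary and ergodic with $0<\mathbb E\sigma_1<\infty$, that the $r_n$ are i.i.d. with an arbitrary distribution on $[0,\infty)$, the $\gamma_n$ are i.i.d. exponential of rate $\lambda$, the $N_n$ are i.i.d. Poisson processes of rate $\lambda$, and that these four families are mutually independent. Let $U$ be an invertible measure preserving transformation of the probability space that shifts all these sequences by one step, and write $U^n\eta=\eta\circ U^n$ for random variables $\eta$. Put $r^*(\lambda)=\mathbb E e^{-\lambda r_1}$ and $\xi_n=N_n(\sigma_n)-\mathbb I\{r_n<\gamma_n\}$. Let $Q_0$ be any $\mathbb Z_{\ge0}$-valued random variable and let $(Q_n)_{n\ge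 0}$ be defined either by the stochastic recursion $Q_{n+1}=(Q_n+\xi_n)^+$, or by the exact dynamics $Q_{n+1}=Q_n-\mathbb I\{Q_n>0,\ r_n<\gamma_n\}+N_n(\sigma_n)$ of the number of customers in orbit at the ends of services. In both cases the following holds. 1. If $\lambda\,\mathbb E\sigma_1<r^*(\lambda)$ and $U^{-k}Q_0=o(k)$ a.s. as $k\to\infty$ (for instance, $Q_0$ is constant), then there is a finite random variable $Q^0$ such that the stationary sequence $Q^n=U^nQ^0$, $n\in\mathbb Z$, satisfies the same recursion a.s., is ergodic, and $(Q_n)$ is strong coupling convergent to $(Q^n)$: with $\nu_k=\min\{n\ge -k:\ U^{-k}Q_{n+k}=Q^n\}$, the random variable $\nu=\sup_{k\ge 0}\nu_k$ is a.s. finite. Moreover $Q^0$ is a.s. unique, both among the random variables $Z$ for which $(U^nZ)_{n\in\mathbb Z}$ satisfies the recursion a.s. and among those for which $\lim_{n\to\infty}\mathbb P\{Q_k=U^kZ\ \forall k\ge n\}=1$. 2. If $\lambda\,\mathbb E\sigma_1>r^*(\lambda)$, then $(Q_n)$ converges in distribution to an improper limiting sequence: $(Q_n,Q_{n+1},\dots)$,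 viewed as a random element of $[-\infty,\infty]^{\mathbb Z_{\ge0}}$, converges in distribution to $(\infty,\infty,\dots)$ as $n\to\infty$. -/

import Mathlib

open MeasureTheory ProbabilityTheory Filter Topology
open scoped NNReal ENNReal

namespace RetrialQueue

/-- `N` is a (homogeneous) Poisson counting process of rate `lam` on `[0, ∞)`. -/
structure IsPoissonProcess {Ω : Type*} [MeasurableSpace Ω] (P : Measure Ω) (lam : ℝ≥0)
    (N : ℝ≥0 → Ω → ℕ) : Prop where
  measurable : ∀ t, Measurable (N t)
  zero : ∀ ω, N 0 ω = 0
  mono : ∀ ω, Monotone (fun t => N t ω)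
  rightCont : ∀ ω t, ContinuousWithinAt (fun s => N s ω) (Set.Ici t) t
  indep_increments : HasIndepIncrements N P
  law_increments : ∀ s t, s ≤ t →
    P.map (fun ω => N t ω - N s ω) = poissonMeasure (lam * (t - s))

/-- The Laplace transform `s ↦ ∫ e^{-s x} dμ(x)` of a distribution `μ` on `[0, ∞)`. -/
noncomputable def laplaceTransform (μ : Measure ℝ≥0) (s : ℝ) : ℝ :=
  ∫ x, Real.exp (-s * (x : ℝ)) ∂μ

/-- The `n`-th iterate (`n ∈ ℤ`) of the invertible transformation `U`. -/
def iter {Ω : Type*} [MeasurableSpace Ω] (U : Ω ≃ᵐ Ω) (n : ℤ) : Ω → Ω :=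
  ⇑((U.toEquiv : Equiv.Perm Ω) ^ n)

/-- The left shift on two-sided sequences. -/
def shift {α : Type*} (x : ℤ → α) : ℤ → α := fun n => x (n + 1)

/-- The random data of a single server retrial queue with the control retrial policy, on a
probability space with an invertible measure preserving transformation `U`, which acts on random
variables by `η ↦ η ∘ U` and shifts all the driving sequences by one step.

The `n`-th cycle starts at the end of the `n`-th service. In this cycle `r n` is the single retrial
time that starts there, `γ n` is the residual time until the next external arrival, `σ n` is the
duration of the service given in the cycle, and `N n t` is the number of external
arrivals during the first `t` time units of that service. -/
structure ControlRetrialQueue {Ω : Type*} [MeasurableSpace Ω] (P : Measure Ω) where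
  /-- the arrival rate -/
  lam : ℝ≥0
  lam_pos : 0 < lam
  U : Ω ≃ᵐ Ω
  measurePreserving : MeasurePreserving U P P
  σ : ℤ → Ω → ℝ≥0
  r : ℤ → Ω → ℝ≥0
  γ : ℤ → Ω → ℝ
  N : ℤ → ℝ≥0 → Ω → ℕ
  measurable_σ : ∀ n, Measurable (σ n)
  measurable_r : ∀ n, Measurable (r n)
  measurable_γ : ∀ n, Measurable (γ n)
  σ_shift : ∀ n ω, σ n (U ω) = σ (n + 1) ω
  r_shift : ∀ n ω, r n (U ω) = r (n + 1) ω
  γ_shift : ∀ n ω, γ n (U ω) = γ (n + 1) ω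
  N_shift : ∀ n t ω, N n t (U ω) = N (n + 1) t ω
  /-- the service times form a stationary ergodic sequence -/
  σ_ergodic : Ergodic (shift (α := ℝ≥0)) (P.map (fun ω n => σ n ω))
  /-- the service times have a finite positive mean -/
  σ_integrable : Integrable (fun ω => (σ 1 ω : ℝ)) P
  σ_mean_pos : 0 < ∫ ω, (σ 1 ω : ℝ) ∂P
  /-- external arrivals are Poisson: residual arrival times are exponential -/
  γ_law : ∀ n, P.map (γ n) = expMeasure (lam : ℝ)
  /-- external arrivals are Poisson: arrivals during a service -/
  N_poisson : ∀ n, IsPoissonProcess P lam (N n)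
  /-- within a cycle, the retrial time, the residual arrival time and the arrivals during
  the service are mutually independent -/
  indep_r_γ : ∀ n, IndepFun (r n) (γ n) P
  indep_r_γ_N : ∀ n, IndepFun (fun ω => (r n ω, γ n ω)) (fun ω t => N n t ω) P
  /-- the triples attached to different cycles are independent -/
  indep_cycles : iIndepFun (fun n ω => (r n ω, γ n ω, fun t => N n t ω)) P
  /-- the service times are independent of everything else -/
  indep_services : IndepFun (fun ω n => σ n ω) (fun ω n => (r n ω, γ n ω, fun t => N n t ω)) P

namespace ControlRetrialQueue

variable {Ω : Type*} [MeasurableSpace Ω] {P : Measure Ω}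

/-- The mean service time `E σ₁`. -/
noncomputable def meanService (M : ControlRetrialQueue P) : ℝ := ∫ ω, (M.σ 1 ω : ℝ) ∂P

/-- `r*(s)`, the Laplace transform of the retrial time distribution. -/
noncomputable def rStar (M : ControlRetrialQueue P) (s : ℝ) : ℝ :=
  laplaceTransform (P.map (M.r 1)) s

open Classical in
/-- `ξ_n = N_λ(σ_n) - 𝟙{r_n < γ_n}`. -/
noncomputable def ξ (M : ControlRetrialQueue P) (n : ℤ) (ω : Ω) : ℤ :=
  (M.N n (M.σ n ω) ω : ℤ) - if (M.r n ω : ℝ) < M.γ n ω then 1 else 0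

/-- The one-step map of the stochastic recursion `Q_{n+1} = (Q_n + ξ_n)⁺`. -/
noncomputable def recursionStep (M : ControlRetrialQueue P) (n : ℤ) (q : ℕ) (ω : Ω) : ℕ :=
  ((q : ℤ) + M.ξ n ω).toNat

open Classical in
/-- The one-step dynamics of the queue itself. If the orbit is non-empty at the end of a service and
the retrial time finishes before the next external arrival, then an orbiting customer enters
service; otherwise the next external customer enters service. In both cases the external
customers arriving during that service join the orbit. -/
noncomputable def queueStep (M : ControlRetrialQueue P) (n : ℤ) (q : ℕ) (ω : Ω) : ℕ :=
  (if 0 < q ∧ (M.r n ω : ℝ) < M.γ n ω then q - 1 else q) + M.N n (M.σ n ω) ω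

end ControlRetrialQueue

/-- The sequence `Q_0, Q_1, …` with `Q_{n+1} = f n Q_n`, started from `Q₀`. -/
def orbitSize {Ω : Type*} (f : ℤ → ℕ → Ω → ℕ) (Q₀ : Ω → ℕ) : ℕ → Ω → ℕ
  | 0, ω => Q₀ ω
  | n + 1, ω => f n (orbitSize f Q₀ n ω) ω

section Convergence

variable {Ω : Type*} [MeasurableSpace Ω]

/-- The coupling time `ν_k = min {n ≥ -k : U^{-k} Q_{n+k} = Qⁿ}`, where `Qⁿ = U^n Z`
(`= ⊤` if there is no such `n`). -/
noncomputable def couplingTime (U : Ω ≃ᵐ Ω) (Q : ℕ → Ω → ℕ) (Z : Ω → ℕ) (k : ℕ) (ω : Ω) : EReal :=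
  ⨅ n ∈ {n : ℤ | -(k : ℤ) ≤ n ∧ Q (n + k).toNat (iter U (-k) ω) = Z (iter U n ω)}, ((n : ℝ) : EReal)

/-- `Q` is strong coupling convergent to the stationary sequence `Qⁿ = U^n Z`:
`ν = sup_{k ≥ 0} ν_k` is almost surely finite. -/
def StrongCouplingConvergent (P : Measure Ω) (U : Ω ≃ᵐ Ω) (Q : ℕ → Ω → ℕ) (Z : Ω → ℕ) : Prop :=
  ∀ᵐ ω ∂P, (⨆ k : ℕ, couplingTime U Q Z k ω) < ⊤

/-- `Q` is coupling convergent to the stationary sequence `Qⁿ = U^n Z`. -/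
def CouplingConvergent (P : Measure Ω) (U : Ω ≃ᵐ Ω) (Q : ℕ → Ω → ℕ) (Z : Ω → ℕ) : Prop :=
  Tendsto (fun n : ℕ => P {ω | ∀ k : ℕ, n ≤ k → Q k ω = Z (iter U k ω)}) atTop (𝓝 1)

/-- The stationary sequence `Qⁿ = U^n Z` satisfies the recursion `Q^{n+1} = f n Qⁿ`, `n ∈ ℤ`. -/
def IsStationarySolution (P : Measure Ω) (U : Ω ≃ᵐ Ω) (f : ℤ → ℕ → Ω → ℕ) (Z : Ω → ℕ) : Prop :=
  Measurable Z ∧ ∀ᵐ ω ∂P, ∀ n : ℤ, Z (iter U (n + 1) ω) = f n (Z (iter U n ω)) ω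

/-- The stationary sequence `Qⁿ = U^n Z`, `n ∈ ℤ`, is ergodic. -/
def IsErgodicSequence (P : Measure Ω) (U : Ω ≃ᵐ Ω) (Z : Ω → ℕ) : Prop :=
  Ergodic (shift (α := ℕ)) (P.map (fun ω n => Z (iter U n ω)))

/-- `U^{-k} Q₀ = o(k)` almost surely. -/
def SublinearStart (P : Measure Ω) (U : Ω ≃ᵐ Ω) (Q₀ : Ω → ℕ) : Prop :=
  ∀ᵐ ω ∂P, Tendsto (fun k : ℕ => (Q₀ (iter U (-k) ω) : ℝ) / k) atTop (𝓝 0)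

/-- The sequences `(Q_n, Q_{n+1}, …)` converge in distribution, as `n → ∞`, to the improper
sequence `(∞, ∞, …)`. -/
def ConvergesToImproper (P : Measure Ω) [IsProbabilityMeasure P] (Q : ℕ → Ω → ℕ) : Prop :=
  TendstoInDistribution (fun (n : ℕ) ω (k : ℕ) => ((Q (n + k) ω : ℝ) : EReal)) atTop
    (fun (_ : Ω) (_ : ℕ) => (⊤ : EReal)) (fun _ => P) P

end Convergence

end RetrialQueue

/-! Both dynamics have the form `q ↦ max (q + ξ) b`, with floor `b = 0` for the recursion and `b`
equal to the number of arrivals for the exact queue; in both cases `0 ≤ b ≤ max 0 (ξ + 1)`.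
Conditioning on the service time and on the retrial time gives `E ξ = λ E σ - r*(λ)`, so the theorem
concerns a Lindley recursion whose stationary increments have negative or positive mean. The
increments are ergodic because the driving data are the product of an ergodic shift (services) and a
Bernoulli shift (cycles): `ergodic_prodMap_shift`. For negative mean, maxima of Birkhoff sums are
a.s. bounded (`bddAbove_birkhoffMax`). Backwards in time this makes Loynes' scheme converge to a
stationary solution. Forwards it sends the free random walk to `-∞`, and two solutions driven by the
same increments agree once the walks from both initial values are non-positive
(`eq_of_add_sum_nonpos`). This gives uniqueness, and strong coupling because a sublinear start is
absorbed by the backward drift. For positive mean the solution dominates a free walk that grows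
linearly. -/

namespace RetrialQueue

/-! ### Ergodicity of the product of an ergodic map and a Bernoulli shift -/

section Bernoulli

variable {X W : Type*} [MeasurableSpace X] [MeasurableSpace W]

lemma measurable_shift : Measurable (shift (α := W)) :=
  measurable_pi_lambda _ fun n => measurable_pi_apply (n + 1)

lemma iterate_shift_apply {α : Type*} (n : ℕ) (y : ℤ → α) (i : ℤ) :
    (shift^[n] y) i = y (i + n) := by
  induction n generalizing y with
  | zero => simp
  | succ n ih =>
    rw [Function.iterate_succ_apply, ih]
    simp only [shift]
    congr 1
    push_cast
    ring

/-- Sets of pairs `(x, y)` that depend only on `x` and finitely many coordinates of `y`. -/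
def finiteCoordinateSets (X W : Type*) [MeasurableSpace X] [MeasurableSpace W] :
    Set (Set (X × (ℤ → W))) :=
  {B | ∃ (s : Finset ℤ) (C : Set (X × (s → W))), MeasurableSet C ∧
    B = (fun p : X × (ℤ → W) => (p.1, s.restrict p.2)) ⁻¹' C}

lemma finiteCoordinateSets_enlarge {s t : Finset ℤ} (hst : s ⊆ t) {C : Set (X × (s → W))}
    (hC : MeasurableSet C) : ∃ D : Set (X × (t → W)), MeasurableSet D ∧
      (fun p : X × (ℤ → W) => (p.1, s.restrict p.2)) ⁻¹' C =
        (fun p : X × (ℤ → W) => (p.1, t.restrict p.2)) ⁻¹' D := by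
  refine ⟨(fun p : X × (t → W) => (p.1, Finset.restrict₂ (π := fun _ => W) hst p.2)) ⁻¹' C, ?_, ?_⟩
  · exact (measurable_fst.prodMk
      ((Finset.measurable_restrict₂ (X := fun _ => W) hst).comp measurable_snd)) hC
  · ext p
    rfl

/-- An algebra that generates the product σ-algebra approximates every measurable set in measure;
`ergodic_prodMap_shift` needs this to replace an invariant set by one with finitely many
coordinates. -/
lemma isSetAlgebra_finiteCoordinateSets : IsSetAlgebra (finiteCoordinateSets X W) where
  empty_mem := ⟨∅, ∅, .empty, by simp⟩
  compl_mem := by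
    rintro _ ⟨s, C, hC, rfl⟩
    exact ⟨s, Cᶜ, hC.compl, by simp⟩
  union_mem := by
    rintro _ _ ⟨s, C, hC, rfl⟩ ⟨t, D, hD, rfl⟩
    obtain ⟨C', hC', hC''⟩ := finiteCoordinateSets_enlarge
      (Finset.subset_union_left (s₁ := s) (s₂ := t)) hC
    obtain ⟨D', hD', hD''⟩ := finiteCoordinateSets_enlarge
      (Finset.subset_union_right (s₁ := s) (s₂ := t)) hD
    exact ⟨s ∪ t, C' ∪ D', hC'.union hD', by rw [hC'', hD'', Set.preimage_union]⟩

lemma generateFrom_finiteCoordinateSets :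
    (inferInstance : MeasurableSpace (X × (ℤ → W))) =
      MeasurableSpace.generateFrom (finiteCoordinateSets X W) := by
  apply le_antisymm
  · refine sup_le ?_ ?_
    · rintro _ ⟨A, hA, rfl⟩
      exact MeasurableSpace.measurableSet_generateFrom
        ⟨∅, Prod.fst ⁻¹' A, measurable_fst hA, rfl⟩
    · rw [MeasurableSpace.comap_le_iff_le_map]
      refine iSup_le fun i => ?_
      rintro _ ⟨A, hA, rfl⟩
      refine MeasurableSpace.measurableSet_generateFrom
        ⟨{i}, (fun p => p.2 ⟨i, Finset.mem_singleton_self i⟩) ⁻¹' A, ?_, rfl⟩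
      exact ((measurable_pi_apply _).comp measurable_snd) hA
  · refine MeasurableSpace.generateFrom_le ?_
    rintro _ ⟨s, C, hC, rfl⟩
    exact (measurable_fst.prodMk ((Finset.measurable_restrict s).comp measurable_snd)) hC

variable {μ : Measure X} {ν : Measure (ℤ → W)} {T : X → X}

/-- A far shift of a set depending on finitely many coordinates is conditionally independent of
the set, given the first component. -/
lemma exists_iterate_inter_section
    (hind : iIndepFun (fun (n : ℤ) (y : ℤ → W) => y n) ν)
    {B : Set (X × (ℤ → W))} (hB : B ∈ finiteCoordinateSets X W) (T : X → X) :
    ∃ n : ℕ, ∀ x, ν (Prod.mk x ⁻¹' (B ∩ (Prod.map T shift)^[n] ⁻¹' B)) =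
      ν (Prod.mk x ⁻¹' B) * ν (Prod.mk x ⁻¹' ((Prod.map T shift)^[n] ⁻¹' B)) := by
  obtain ⟨s, C, hC, rfl⟩ := hB
  -- A translation by more than the diameter of `s` makes the two windows of coordinates disjoint.
  obtain ⟨n, hn⟩ : ∃ n : ℕ, Disjoint s (s.map (addRightEmbedding (n : ℤ))) := by
    obtain ⟨a, ha⟩ := s.bddAbove
    obtain ⟨b, hb⟩ := s.bddBelow
    refine ⟨(a - b + 1).toNat, Finset.disjoint_left.2 fun i hi hi' => ?_⟩
    obtain ⟨j, hj, rfl⟩ := Finset.mem_map.1 hi'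
    have h1 := ha hi
    have h2 := hb hj
    simp only [addRightEmbedding_apply] at h1
    omega
  refine ⟨n, fun x => ?_⟩
  have h1 := hind.indepFun_finset s (s.map (addRightEmbedding (n : ℤ))) hn
    (fun i => measurable_pi_apply i)
  -- `ρ` relabels the translated window by `s`, so both events are expressed through the same `C`,
  -- with base points `x` and `T^[n] x`.
  let ρ : (s.map (addRightEmbedding (n : ℤ)) → W) → (s → W) :=
    fun z i => z ⟨(i : ℤ) + n, Finset.mem_map_of_mem (addRightEmbedding (n : ℤ)) i.2⟩
  have hρ : Measurable ρ := measurable_pi_lambda _ fun i => measurable_pi_apply _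
  have h2 := h1.comp measurable_id hρ
  have h3 := h2.measure_inter_preimage_eq_mul (Prod.mk x ⁻¹' C) (Prod.mk (T^[n] x) ⁻¹' C)
    (measurable_prodMk_left hC) (measurable_prodMk_left hC)
  have h4 : Prod.mk x ⁻¹' ((Prod.map T shift)^[n] ⁻¹'
      ((fun p : X × (ℤ → W) => (p.1, s.restrict p.2)) ⁻¹' C)) =
      (ρ ∘ fun a i => a i) ⁻¹' (Prod.mk (T^[n] x) ⁻¹' C) := by
    ext y
    simp only [Set.mem_preimage, Prod.map_iterate, Prod.map_apply, Function.comp_apply]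
    refine iff_of_eq (congrArg (fun z => (T^[n] x, z) ∈ C) ?_)
    ext i
    simp [iterate_shift_apply, ρ]
  rw [Set.preimage_inter, h4]
  exact h3

variable [IsProbabilityMeasure μ] [IsProbabilityMeasure ν]

lemma measurePreserving_prodMap_shift (hT : Ergodic T μ) (hν : MeasurePreserving shift ν ν) :
    MeasurePreserving (Prod.map T (shift (α := W))) (μ.prod ν) (μ.prod ν) :=
  hT.toMeasurePreserving.prod hν

/-- The product of an ergodic transformation and a Bernoulli shift is ergodic. -/
theorem ergodic_prodMap_shift (hT : Ergodic T μ) (hν : MeasurePreserving shift ν ν)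
    (hind : iIndepFun (fun (n : ℤ) (y : ℤ → W) => y n) ν) :
    Ergodic (Prod.map T (shift (α := W))) (μ.prod ν) := by
  have hmp := measurePreserving_prodMap_shift hT hν
  refine ⟨hmp, ⟨fun {A} hA hinv => ?_⟩⟩
  set κ := μ.prod ν with hκ
  set Φ : X × (ℤ → W) → X × (ℤ → W) := Prod.map T shift with hΦ
  have hsec : ∀ {B : Set (X × (ℤ → W))}, MeasurableSet B →
      Measurable (fun x => ν.real (Prod.mk x ⁻¹' B)) := fun hB =>
    (measurable_measure_prodMk_left hB).ennreal_toReal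
  have hint : ∀ {B : Set (X × (ℤ → W))}, MeasurableSet B →
      κ.real B = ∫ x, ν.real (Prod.mk x ⁻¹' B) ∂μ := fun {B} hB => by
    rw [measureReal_def, hκ, Measure.prod_apply hB, integral_eq_lintegral_of_nonneg_ae
      (ae_of_all _ fun x => measureReal_nonneg) (hsec hB).aestronglyMeasurable]
    congr 1
    exact lintegral_congr fun x => by simp [measureReal_def]
  have hbdd : ∀ (B : Set (X × (ℤ → W))), MeasurableSet B →
      Integrable (fun x => ν.real (Prod.mk x ⁻¹' B)) μ := fun B hB =>
    Integrable.of_bound (hsec hB).aestronglyMeasurable 1 (ae_of_all _ fun x => by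
      rw [Real.norm_of_nonneg measureReal_nonneg]; exact measureReal_le_one)
  -- the measure of the sections is constant
  have hFT : (fun x => ν.real (Prod.mk x ⁻¹' A)) ∘ T = fun x => ν.real (Prod.mk x ⁻¹' A) := by
    funext x
    -- Invariance of `A` makes the section at `x` the shift-preimage of the section at `T x`, and
    -- `ν` is shift invariant.
    have h1 : shift ⁻¹' (Prod.mk (T x) ⁻¹' A) = Prod.mk x ⁻¹' A := by
      conv_rhs => rw [← hinv]
      rfl
    simp only [Function.comp, measureReal_def]
    rw [← h1, hν.measure_preimage (measurable_prodMk_left hA).nullMeasurableSet]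
  obtain ⟨c, hc⟩ := hT.toPreErgodic.ae_eq_const_of_ae_eq_comp (hsec hA) hFT
  have hc' : κ.real A = c := by
    rw [hint hA, integral_congr_ae hc]
    simp
  have hc0 : 0 ≤ c := hc' ▸ measureReal_nonneg
  have hc1 : c ≤ 1 := hc' ▸ measureReal_le_one
  -- the key estimate
  have key : ∀ ε : ℝ, 0 < ε → |c - c * c| ≤ 4 * ε := by
    intro ε hε
    -- Both `B` and its far translate `B'` approximate the invariant set `A`, yet their sections are
    -- independent. Hence `c ≈ κ (B ∩ B') ≈ c * c`, which forces `c` to be 0 or 1.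
    obtain ⟨B, hB, hAB⟩ := (Measure.MeasureDense.of_generateFrom_isSetAlgebra_finite κ
      isSetAlgebra_finiteCoordinateSets generateFrom_finiteCoordinateSets).approx A hA
        (measure_ne_top _ _) ε hε
    have hBm : MeasurableSet B := by
      obtain ⟨s, C, hC, rfl⟩ := hB
      exact (measurable_fst.prodMk ((Finset.measurable_restrict s).comp measurable_snd)) hC
    obtain ⟨n, hn⟩ := exists_iterate_inter_section hind hB T
    set B' := Φ^[n] ⁻¹' B with hB'
    have hmpn := hmp.iterate n
    have hBm' : MeasurableSet B' := hmpn.measurable hBm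
    have hAinv : Φ^[n] ⁻¹' A = A := by
      rw [Set.preimage_iterate_eq]
      exact Function.iterate_fixed hinv n
    have hr1 : κ.real (symmDiff A B) ≤ ε := by
      rw [measureReal_def]
      exact ENNReal.toReal_le_of_le_ofReal hε.le hAB.le
    have hr2 : κ.real (symmDiff A B') ≤ ε := by
      have : symmDiff A B' = Φ^[n] ⁻¹' (symmDiff A B) := by
        rw [Set.preimage_symmDiff, hAinv]
      rw [this, measureReal_def, hmpn.measure_preimage (hA.symmDiff hBm).nullMeasurableSet]
      exact hr1
    -- Almost every section of `A` has measure `c`, so the sections of `D` deviate from `c` by at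
    -- most the measure of the sections of the symmetric difference.
    have hdist : ∀ D : Set (X × (ℤ → W)), MeasurableSet D → κ.real (symmDiff A D) ≤ ε →
        ∫ x, |ν.real (Prod.mk x ⁻¹' D) - c| ∂μ ≤ ε := by
      intro D hD hAD
      refine le_trans ?_ hAD
      rw [hint (hA.symmDiff hD)]
      refine integral_mono_ae ((hbdd D hD).sub (integrable_const c)).abs
        (hbdd _ (hA.symmDiff hD)) ?_
      filter_upwards [hc] with x hx
      simp only [Function.const_apply] at hx
      rw [← hx, abs_sub_comm, Set.preimage_symmDiff]
      exact abs_measureReal_sub_le_measureReal_symmDiff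
        (measurable_prodMk_left hA).nullMeasurableSet
        (measurable_prodMk_left hD).nullMeasurableSet
    have hd1 := hdist B hBm hr1
    have hd2 := hdist B' hBm' hr2
    have hinter : κ.real (symmDiff A (B ∩ B')) ≤ 2 * ε := by
      have : symmDiff A (B ∩ B') ⊆ symmDiff A B ∪ symmDiff A B' := by
        intro p hp
        simp only [Set.mem_symmDiff, Set.mem_inter_iff, Set.mem_union] at hp ⊢
        tauto
      have h := (measureReal_mono this).trans (measureReal_union_le (μ := κ) _ _)
      linarith
    have e1 : |c - κ.real (B ∩ B')| ≤ 2 * ε := by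
      rw [← hc']
      exact (abs_measureReal_sub_le_measureReal_symmDiff hA.nullMeasurableSet
        (hBm.inter hBm').nullMeasurableSet).trans hinter
    have e2 : |κ.real (B ∩ B') - c * c| ≤ 2 * ε := by
      have h1 : κ.real (B ∩ B') - c * c =
          ∫ x, (ν.real (Prod.mk x ⁻¹' B) * ν.real (Prod.mk x ⁻¹' B') - c * c) ∂μ := by
        rw [hint (hBm.inter hBm')]
        have h2 : ∀ x, ν.real (Prod.mk x ⁻¹' (B ∩ B')) =
            ν.real (Prod.mk x ⁻¹' B) * ν.real (Prod.mk x ⁻¹' B') := fun x => by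
          simp only [measureReal_def]
          rw [hn x, ENNReal.toReal_mul]
        rw [integral_sub _ (integrable_const _)]
        · simp_rw [h2]
          simp
        · simpa only [h2] using hbdd _ (hBm.inter hBm')
      rw [h1]
      refine (abs_integral_le_integral_abs).trans ?_
      have h3 : ∫ x, |ν.real (Prod.mk x ⁻¹' B) * ν.real (Prod.mk x ⁻¹' B') - c * c| ∂μ ≤
          ∫ x, (|ν.real (Prod.mk x ⁻¹' B) - c| + |ν.real (Prod.mk x ⁻¹' B') - c|) ∂μ := by
        refine integral_mono_of_nonneg (ae_of_all _ fun x => abs_nonneg _)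
          (((hbdd _ hBm).sub (integrable_const c)).abs.add
            ((hbdd _ hBm').sub (integrable_const c)).abs) (ae_of_all _ fun x => ?_)
        have hb0 : 0 ≤ ν.real (Prod.mk x ⁻¹' B') := measureReal_nonneg
        have hb1 : ν.real (Prod.mk x ⁻¹' B') ≤ 1 := measureReal_le_one
        set u := ν.real (Prod.mk x ⁻¹' B)
        set v := ν.real (Prod.mk x ⁻¹' B')
        calc |u * v - c * c| = |(u - c) * v + c * (v - c)| := by ring_nf
          _ ≤ |(u - c) * v| + |c * (v - c)| := abs_add_le _ _
          _ = |u - c| * v + c * |v - c| := by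
            rw [abs_mul, abs_mul, abs_of_nonneg hb0, abs_of_nonneg hc0]
          _ ≤ |u - c| + |v - c| := by
            nlinarith [abs_nonneg (u - c), abs_nonneg (v - c)]
      have h4 : ∫ x, (|ν.real (Prod.mk x ⁻¹' B) - c| + |ν.real (Prod.mk x ⁻¹' B') - c|) ∂μ =
          ∫ x, |ν.real (Prod.mk x ⁻¹' B) - c| ∂μ + ∫ x, |ν.real (Prod.mk x ⁻¹' B') - c| ∂μ :=
        integral_add ((hbdd _ hBm).sub (integrable_const c)).abs
          ((hbdd _ hBm').sub (integrable_const c)).abs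
      linarith
    calc |c - c * c| = |(c - κ.real (B ∩ B')) + (κ.real (B ∩ B') - c * c)| := by ring_nf
      _ ≤ _ := abs_add_le _ _
      _ ≤ 4 * ε := by linarith
  have hcc : c - c * c = 0 := by
    rw [← abs_eq_zero]
    refine le_antisymm (le_of_forall_pos_le_add fun ε hε => ?_) (abs_nonneg _)
    have := key (ε / 4) (by positivity)
    linarith
  have h01 : c = 0 ∨ c = 1 := by
    rcases mul_eq_zero.1 (show c * (1 - c) = 0 by linarith) with h | h
    · exact Or.inl h
    · exact Or.inr (by linarith)
  rw [eventuallyConst_set']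
  rcases h01 with h | h
  · left
    rw [ae_eq_empty]
    rw [h] at hc'
    exact (measureReal_eq_zero_iff).1 hc'
  · right
    rw [ae_eq_univ]
    rw [prob_compl_eq_zero_iff hA]
    rw [h, measureReal_def] at hc'
    exact (ENNReal.toReal_eq_one_iff _).1 hc'

end Bernoulli

/-! ### Maxima of Birkhoff sums and a one-sided ergodic theorem -/

section Loynes

variable {E : Type*} {T : E → E} {f : E → ℝ}

/-- The maximum of the Birkhoff sums of `f` up to time `n`. -/
noncomputable def birkhoffMax (T : E → E) (f : E → ℝ) : ℕ → E → ℝ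
  | 0, _ => 0
  | n + 1, e => max 0 (f e + birkhoffMax T f n (T e))

lemma birkhoffMax_nonneg (n : ℕ) (e : E) : 0 ≤ birkhoffMax T f n e := by
  cases n with
  | zero => exact le_rfl
  | succ n => exact le_max_left _ _

lemma birkhoffMax_le_succ (n : ℕ) (e : E) : birkhoffMax T f n e ≤ birkhoffMax T f (n + 1) e := by
  induction n generalizing e with
  | zero => exact birkhoffMax_nonneg _ _
  | succ n ih => exact max_le_max le_rfl (add_le_add le_rfl (ih _))

lemma birkhoffMax_mono (e : E) : Monotone fun n => birkhoffMax T f n e :=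
  monotone_nat_of_le_succ fun n => birkhoffMax_le_succ n e

lemma birkhoffSum_le_birkhoffMax (n : ℕ) (e : E) :
    birkhoffSum T f n e ≤ birkhoffMax T f n e := by
  induction n generalizing e with
  | zero => simp [birkhoffMax]
  | succ n ih =>
    rw [birkhoffSum_succ']
    exact (add_le_add le_rfl (ih _)).trans (le_max_right _ _)

variable [MeasurableSpace E] {μ : Measure E}

lemma measurable_birkhoffMax (hT : Measurable T) (hf : Measurable f) (n : ℕ) :
    Measurable (birkhoffMax T f n) := by
  induction n with
  | zero => exact measurable_const
  | succ n ih => exact measurable_const.max (hf.add (ih.comp hT))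

lemma integrable_birkhoffMax (hT : MeasurePreserving T μ μ) (hf : Integrable f μ) (n : ℕ) :
    Integrable (birkhoffMax T f n) μ := by
  induction n with
  | zero => exact integrable_zero _ _ _
  | succ n ih =>
    exact (integrable_zero E ℝ μ).sup (hf.add (hT.integrable_comp_of_integrable ih))

/-- Birkhoff sums of a function with negative mean are bounded above. -/
theorem bddAbove_birkhoffMax [IsFiniteMeasure μ] (hT : Ergodic T μ) (hf : Measurable f) (hfi : Integrable f μ)
    (hneg : ∫ e, f e ∂μ < 0) : ∀ᵐ e ∂μ, BddAbove (Set.range fun n => birkhoffMax T f n e) := by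
  set B := {e | BddAbove (Set.range fun n => birkhoffMax T f n e)} with hB
  have hBm : MeasurableSet B :=
    measurableSet_bddAbove_range fun n => measurable_birkhoffMax hT.measurable hf n
  -- The recursion `M (n + 1) = max 0 (f + M n ∘ T)` transfers bounds both ways, so by ergodicity
  -- boundedness has probability 0 or 1 when `μ` is a probability.
  have hinv : T ⁻¹' B = B := by
    ext e
    constructor
    · rintro ⟨C, hC⟩
      refine ⟨max 0 (f e + C), ?_⟩
      rintro _ ⟨n, rfl⟩
      cases n with
      | zero => exact le_max_left _ _
      | succ n => exact max_le_max le_rfl (add_le_add le_rfl (hC ⟨n, rfl⟩))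
    · rintro ⟨C, hC⟩
      refine ⟨C - f e, ?_⟩
      rintro _ ⟨n, rfl⟩
      have h1 : birkhoffMax T f (n + 1) e ≤ C := hC ⟨n + 1, rfl⟩
      have h2 : f e + birkhoffMax T f n (T e) ≤ birkhoffMax T f (n + 1) e := le_max_right _ _
      simp only
      linarith
  rcases hT.toPreErgodic.ae_mem_or_ae_notMem hBm hinv with h | h
  · exact h
  exfalso
  have htop : ∀ᵐ e ∂μ, Tendsto (fun n => birkhoffMax T f n e) atTop atTop := by
    filter_upwards [h] with e he
    exact tendsto_atTop_atTop_of_monotone' (birkhoffMax_mono e) he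
  -- The integrand equals `M (n + 1) - M n ∘ T`. If `M` tends to infinity it converges to `f`,
  -- dominated by `|f|`; but its integral is non-negative because `M` increases in `n` and `T`
  -- preserves `μ`. This contradicts the negative mean.
  have hlim : Tendsto (fun n => ∫ e, max (-birkhoffMax T f n (T e)) (f e) ∂μ) atTop
      (𝓝 (∫ e, f e ∂μ)) := by
    refine tendsto_integral_of_dominated_convergence (fun e => |f e|) (fun n => ?_) hfi.abs
      (fun n => ae_of_all _ fun e => ?_) ?_
    · exact (((measurable_birkhoffMax hT.measurable hf n).comp hT.measurable).neg.max
        hf).aestronglyMeasurable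
    · have := birkhoffMax_nonneg (T := T) (f := f) n (T e)
      rw [Real.norm_eq_abs]
      rcases max_cases (-birkhoffMax T f n (T e)) (f e) with ⟨h1, h2⟩ | ⟨h1, h2⟩
      · rw [h1]
        exact abs_le_abs_of_nonpos (by linarith) h2
      · rw [h1]
    · filter_upwards [hT.quasiMeasurePreserving.ae htop] with e he
      refine tendsto_const_nhds.congr' ?_
      filter_upwards [he.eventually_ge_atTop (-f e)] with n hn
      rw [max_eq_right (by linarith)]
  refine absurd (ge_of_tendsto' hlim fun n => ?_) (not_le.2 hneg)
  have h1 : ∀ e, max (-birkhoffMax T f n (T e)) (f e) =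
      birkhoffMax T f (n + 1) e - birkhoffMax T f n (T e) := fun e => by
    simp only [birkhoffMax]
    rw [← max_sub_sub_right]
    simp
  have hmp := hT.toMeasurePreserving
  simp_rw [h1]
  have h3 : ∫ e, (birkhoffMax T f (n + 1) e - birkhoffMax T f n (T e)) ∂μ =
      ∫ e, birkhoffMax T f (n + 1) e ∂μ - ∫ e, birkhoffMax T f n (T e) ∂μ :=
    integral_sub (integrable_birkhoffMax hmp hfi _)
      (hmp.integrable_comp_of_integrable (integrable_birkhoffMax hmp hfi n))
  have h2 : ∫ e, birkhoffMax T f n (T e) ∂μ = ∫ e, birkhoffMax T f n e ∂μ := by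
    conv_rhs => rw [← hmp.map_eq]
    rw [integral_map hmp.aemeasurable
      (measurable_birkhoffMax hT.measurable hf n).aestronglyMeasurable]
  rw [h3, h2, sub_nonneg]
  exact integral_mono (integrable_birkhoffMax hmp hfi _) (integrable_birkhoffMax hmp hfi _)
    fun e => birkhoffMax_le_succ n e

variable [IsProbabilityMeasure μ]

/-- The upper half of the pointwise ergodic theorem, with an explicit affine bound. -/
theorem birkhoffSum_le_affine (hT : Ergodic T μ) (hf : Measurable f) (hfi : Integrable f μ)
    {a : ℝ} (ha : ∫ e, f e ∂μ < a) :
    ∀ᵐ e ∂μ, ∃ C : ℝ, ∀ n : ℕ, birkhoffSum T f n e ≤ n * a + C := by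
  have h := bddAbove_birkhoffMax hT (hf.sub_const a) (hfi.sub (integrable_const a)) (by
    rw [integral_sub hfi (integrable_const a)]
    simpa using ha)
  filter_upwards [h] with e ⟨C, hC⟩
  refine ⟨C, fun n => ?_⟩
  have h1 := (birkhoffSum_le_birkhoffMax n e).trans (hC ⟨n, rfl⟩)
  have h2 : birkhoffSum T (fun e => f e - a) n e = birkhoffSum T f n e - n * a := by
    simp [birkhoffSum, Finset.sum_sub_distrib]
  linarith

end Loynes

/-! ### Integer iterates of an invertible transformation -/

section Iterates

variable {Ω : Type*} [MeasurableSpace Ω]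

@[simp] lemma iter_zero (U : Ω ≃ᵐ Ω) (ω : Ω) : iter U 0 ω = ω := rfl

lemma iter_add (U : Ω ≃ᵐ Ω) (m n : ℤ) (ω : Ω) : iter U (m + n) ω = iter U m (iter U n ω) := by
  simp [iter, zpow_add]

@[simp] lemma iter_one (U : Ω ≃ᵐ Ω) (ω : Ω) : iter U 1 ω = U ω := by
  simp [iter]

lemma iter_neg_one (U : Ω ≃ᵐ Ω) (ω : Ω) : iter U (-1) ω = U.symm ω := by
  simp [iter]

lemma iter_add_one (U : Ω ≃ᵐ Ω) (n : ℤ) (ω : Ω) : iter U (n + 1) ω = U (iter U n ω) := by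
  rw [add_comm, iter_add, iter_one]

lemma iter_natCast (U : Ω ≃ᵐ Ω) (n : ℕ) (ω : Ω) : iter U n ω = U^[n] ω := by
  induction n with
  | zero => rfl
  | succ n ih => rw [Nat.cast_succ, iter_add_one, ih, Function.iterate_succ_apply']

lemma iter_neg_natCast (U : Ω ≃ᵐ Ω) (n : ℕ) (ω : Ω) : iter U (-n) ω = U.symm^[n] ω := by
  induction n with
  | zero => rfl
  | succ n ih =>
    rw [Nat.cast_succ, neg_add, add_comm, iter_add, iter_neg_one, ih,
      Function.iterate_succ_apply']

lemma measurePreserving_iter {P : Measure Ω} {U : Ω ≃ᵐ Ω} (hU : MeasurePreserving U P P) (n : ℤ) :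
    MeasurePreserving (iter U n) P P := by
  rcases n.eq_nat_or_neg with ⟨n, rfl | rfl⟩
  · rw [show iter U n = U^[n] from funext (iter_natCast U n)]
    exact hU.iterate n
  · rw [show iter U (-n) = U.symm^[n] from funext (iter_neg_natCast U n)]
    exact (hU.symm U).iterate n

lemma map_iter {E : Type*} [MeasurableSpace E] {U : Ω ≃ᵐ Ω} {Θ : E ≃ᵐ E} {V : Ω → E}
    (hVU : ∀ ω, V (U ω) = Θ (V ω)) (n : ℤ) (ω : Ω) : V (iter U n ω) = iter Θ n (V ω) := by
  rcases n.eq_nat_or_neg with ⟨n, rfl | rfl⟩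
  · rw [iter_natCast, iter_natCast]
    exact (show Function.Semiconj V U Θ from hVU).iterate_right n ω
  · rw [iter_neg_natCast, iter_neg_natCast]
    refine (show Function.Semiconj V U.symm Θ.symm from fun ω => ?_).iterate_right n ω
    rw [MeasurableEquiv.eq_symm_apply, ← hVU, U.apply_symm_apply]

end Iterates

/-! ### Pathwise comparison with the free random walk -/

section Deterministic

variable {u v : ℕ → ℕ} {x b : ℕ → ℤ}

/-- The floor can only push the solution upwards. This gives divergence in the unstable case, and in
the stable case it bounds the walk started from the stationary solution in the past. -/
lemma add_sum_le_of_recursion (hu : ∀ n, (u (n + 1) : ℤ) = max (u n + x n) (b n)) (n : ℕ) :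
    u 0 + ∑ i ∈ Finset.range n, x i ≤ u n := by
  induction n with
  | zero => simp
  | succ n ih =>
    rw [Finset.sum_range_succ, hu]
    exact le_trans (by linarith) (le_max_left _ _)

/-- Two solutions of the same recursion coincide as soon as the free random walks started from
both initial values are non-positive. -/
lemma eq_of_add_sum_nonpos (hu : ∀ n, (u (n + 1) : ℤ) = max (u n + x n) (b n))
    (hv : ∀ n, (v (n + 1) : ℤ) = max (v n + x n) (b n)) {n : ℕ}
    (hun : u 0 + ∑ i ∈ Finset.range n, x i ≤ 0) (hvn : v 0 + ∑ i ∈ Finset.range n, x i ≤ 0) :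
    u n = v n := by
  -- As long as the solutions differ, the larger one has followed the free walk: if the floor
  -- overtakes it, both jump to the floor and merge. At time `n` that walk is non-positive, so
  -- unmerged solutions would both be 0.
  have key : ∀ m : ℕ, u m = v m ∨
      max (u m : ℤ) (v m) = max (u 0 : ℤ) (v 0) + ∑ i ∈ Finset.range m, x i := by
    intro m
    induction m with
    | zero => simp
    | succ m ih =>
      have h1 := hu m
      have h2 := hv m
      rw [Finset.sum_range_succ]
      omega
  have := key n
  omega

end Deterministic

/-! ### Loynes' construction of the stationary solution -/

section Stationary

variable {E : Type*} [MeasurableSpace E] {Θ : E ≃ᵐ E} {x b : E → ℤ}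

/-- Loynes' scheme: the value at time `0` of the recursion `q ↦ max (q + x) b` started from `0` at
time `-k`. -/
def loynesScheme (Θ : E ≃ᵐ E) (x b : E → ℤ) : ℕ → E → ℕ
  | 0, _ => 0
  | k + 1, e => (max (loynesScheme Θ x b k (Θ.symm e) + x (Θ.symm e)) (b (Θ.symm e))).toNat

lemma loynesScheme_succ_map (hb : ∀ e, 0 ≤ b e) (k : ℕ) (e : E) :
    (loynesScheme Θ x b (k + 1) (Θ e) : ℤ) = max (loynesScheme Θ x b k e + x e) (b e) := by
  simp only [loynesScheme, MeasurableEquiv.symm_apply_apply]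
  exact Int.toNat_of_nonneg (le_max_of_le_right (hb e))

lemma measurable_loynesScheme (hx : Measurable x) (hb : Measurable b) (k : ℕ) :
    Measurable (loynesScheme Θ x b k) := by
  induction k with
  | zero => exact measurable_const
  | succ k ih =>
    have h1 : Measurable fun e => (loynesScheme Θ x b k (Θ.symm e) : ℤ) :=
      (measurable_of_countable _).comp (ih.comp Θ.symm.measurable)
    exact (measurable_of_countable Int.toNat).comp
      ((h1.add (hx.comp Θ.symm.measurable)).max (hb.comp Θ.symm.measurable))

/-- The floor exceeds `max 0 x` by at most one. The excess does not accumulate, since hitting the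
floor discards the previous value; hence a single extra unit suffices for every `k`. -/
lemma loynesScheme_le_birkhoffMax (hb : ∀ e, b e ≤ max 0 (x e + 1)) (k : ℕ) (e : E) :
    (loynesScheme Θ x b k e : ℝ) ≤ birkhoffMax Θ.symm (fun e => (x (Θ.symm e) : ℝ)) k e + 1 := by
  induction k generalizing e with
  | zero => simp [loynesScheme, birkhoffMax]
  | succ k ih =>
    have h1 := ih (Θ.symm e)
    set m := birkhoffMax Θ.symm (fun e => (x (Θ.symm e) : ℝ)) k (Θ.symm e) with hm
    have hm0 : 0 ≤ m := birkhoffMax_nonneg _ _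
    have h2 : ((loynesScheme Θ x b (k + 1) e : ℕ) : ℝ) =
        max (max (loynesScheme Θ x b k (Θ.symm e) + x (Θ.symm e) : ℝ) (b (Θ.symm e))) 0 := by
      simp only [loynesScheme]
      rw [← Int.cast_natCast (R := ℝ), Int.toNat_eq_max]
      push_cast
      rfl
    have h3 : (b (Θ.symm e) : ℝ) ≤ max (0 : ℝ) ((x (Θ.symm e) : ℝ) + 1) := by exact_mod_cast hb (Θ.symm e)
    rw [h2]
    simp only [birkhoffMax, ← hm]
    have h4 := le_max_left (0 : ℝ) ((x (Θ.symm e) : ℝ) + m)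
    have h5 := le_max_right (0 : ℝ) ((x (Θ.symm e) : ℝ) + m)
    refine max_le (max_le (by linarith) (h3.trans (max_le ?_ ?_))) ?_ <;> linarith

/-- The limit of Loynes' scheme. -/
noncomputable def loynesLimit (Θ : E ≃ᵐ E) (x b : E → ℤ) (e : E) : ℕ :=
  -- For an unbounded family of naturals this supremum is 0; such points form a null set in the
  -- stable case.
  ⨆ k, loynesScheme Θ x b k e

lemma measurable_loynesLimit (hx : Measurable x) (hb : Measurable b) :
    Measurable (loynesLimit Θ x b) :=
  Measurable.iSup fun k => measurable_loynesScheme hx hb k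

/-- A bounded supremum of naturals is attained, at some `k₀`. The one-step map is monotone, so at `Θ
e` the supremum is attained at `k₀ + 1`, and the one-step identity there is the claim. -/
lemma loynesLimit_map (hb : ∀ e, 0 ≤ b e) {e : E}
    (h : BddAbove (Set.range fun k => loynesScheme Θ x b k e)) :
    (loynesLimit Θ x b (Θ e) : ℤ) = max (loynesLimit Θ x b e + x e) (b e) := by
  obtain ⟨k₀, hk₀⟩ : ∃ k, loynesScheme Θ x b k e = loynesLimit Θ x b e :=
    Nat.sSup_mem (Set.range_nonempty _) h
  have hle : ∀ k, loynesScheme Θ x b k e ≤ loynesLimit Θ x b e := fun k => le_ciSup h k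
  have hle' : ∀ k, loynesScheme Θ x b k (Θ e) ≤ loynesScheme Θ x b (k₀ + 1) (Θ e) := by
    intro k
    cases k with
    | zero => exact Nat.zero_le _
    | succ k =>
      have h1 := loynesScheme_succ_map (Θ := Θ) (x := x) hb k e
      have h2 := loynesScheme_succ_map (Θ := Θ) (x := x) hb k₀ e
      have h3 := hle k
      rw [hk₀] at h2
      omega
  have h4 : loynesLimit Θ x b (Θ e) = loynesScheme Θ x b (k₀ + 1) (Θ e) :=
    le_antisymm (ciSup_le hle') (le_ciSup (f := fun k => loynesScheme Θ x b k (Θ e))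
      ⟨_, Set.forall_mem_range.2 hle'⟩ (k₀ + 1))
  rw [h4, loynesScheme_succ_map hb, hk₀]

variable {μ : Measure E}

lemma integral_comp_symm (hΘ : MeasurePreserving Θ μ μ) (f : E → ℝ) :
    ∫ e, f (Θ.symm e) ∂μ = ∫ e, f e ∂μ :=
  (hΘ.symm Θ).integral_comp' f

/-- In the stable case, the limit of Loynes' scheme is a stationary solution. -/
theorem ae_loynesLimit_map [IsFiniteMeasure μ] (hΘ : Ergodic Θ μ) (hx : Measurable x) (hb₀ : ∀ e, 0 ≤ b e)
    (hb₁ : ∀ e, b e ≤ max 0 (x e + 1)) (hxi : Integrable (fun e => (x e : ℝ)) μ)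
    (hneg : ∫ e, (x e : ℝ) ∂μ < 0) :
    ∀ᵐ e ∂μ, (loynesLimit Θ x b (Θ e) : ℤ) = max (loynesLimit Θ x b e + x e) (b e) := by
  have hx' : Measurable fun e => (x e : ℝ) := (measurable_of_countable _).comp hx
  have hmp := hΘ.toMeasurePreserving
  -- The scheme reads increments from the past, so the maximal bound is applied to the inverse map.
  have h := bddAbove_birkhoffMax (f := fun e => (x (Θ.symm e) : ℝ)) hΘ.symm
    (hx'.comp Θ.symm.measurable) ((hmp.symm Θ).integrable_comp_of_integrable hxi)
    (by rwa [integral_comp_symm hmp (fun e => (x e : ℝ))])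
  filter_upwards [h] with e ⟨C, hC⟩
  refine loynesLimit_map hb₀ ⟨⌈C + 1⌉₊, ?_⟩
  rintro _ ⟨k, rfl⟩
  have h1 := loynesScheme_le_birkhoffMax (Θ := Θ) hb₁ k e
  have h2 := hC ⟨k, rfl⟩
  exact_mod_cast (h1.trans (add_le_add h2 le_rfl)).trans (Nat.le_ceil _)

end Stationary

/-! ### Stability and instability of the recursion over an ergodic factor -/

/-- The recursion `Q_{n+1} = max (Q_n + x_n) b_n`, driven by an ergodic factor `(E, Θ)` of the
dynamical system `(Ω, U)`. -/
structure IsLindleyRecursion {Ω E : Type*} [MeasurableSpace Ω] [MeasurableSpace E] (P : Measure Ω)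
    (U : Ω ≃ᵐ Ω) (Θ : E ≃ᵐ E) (V : Ω → E) (x b : E → ℤ) (f : ℤ → ℕ → Ω → ℕ) : Prop where
  measurePreserving : MeasurePreserving U P P
  measurable_factor : Measurable V
  factor_map : ∀ ω, V (U ω) = Θ (V ω)
  ergodic : Ergodic Θ (P.map V)
  measurable_step : Measurable x
  measurable_floor : Measurable b
  floor_nonneg : ∀ e, 0 ≤ b e
  floor_le : ∀ e, b e ≤ max 0 (x e + 1)
  integrable_step : Integrable (fun e => (x e : ℝ)) (P.map V)
  recursion : ∀ n q ω,
    (f n q ω : ℤ) = max (q + x (V (iter U n ω))) (b (V (iter U n ω)))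

namespace IsLindleyRecursion

variable {Ω E : Type*} [MeasurableSpace Ω] [MeasurableSpace E] {P : Measure Ω}
  {U : Ω ≃ᵐ Ω} {Θ : E ≃ᵐ E} {V : Ω → E} {x b : E → ℤ} {f : ℤ → ℕ → Ω → ℕ} {Q₀ Z Z' : Ω → ℕ}

lemma orbitSize_succ (h : IsLindleyRecursion P U Θ V x b f) (n : ℕ) (ω : Ω) :
    (orbitSize f Q₀ (n + 1) ω : ℤ) =
      max (orbitSize f Q₀ n ω + x (V (iter U n ω))) (b (V (iter U n ω))) :=
  h.recursion n _ ω

lemma measurable_orbitSize (h : IsLindleyRecursion P U Θ V x b f) (hQ₀ : Measurable Q₀) (n : ℕ) :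
    Measurable (orbitSize f Q₀ n) := by
  induction n with
  | zero => exact hQ₀
  | succ n ih =>
    have h1 : orbitSize f Q₀ (n + 1) = fun ω =>
        (max (orbitSize f Q₀ n ω + x (V (iter U n ω))) (b (V (iter U n ω)))).toNat := by
      funext ω
      rw [← h.orbitSize_succ n ω, Int.toNat_natCast]
    have hV : Measurable fun ω => V (iter U n ω) :=
      h.measurable_factor.comp (measurePreserving_iter h.measurePreserving n).measurable
    rw [h1]
    exact (measurable_of_countable Int.toNat).comp
      ((((measurable_of_countable (Nat.cast : ℕ → ℤ)).comp ih).add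
        (h.measurable_step.comp hV)).max (h.measurable_floor.comp hV))

lemma birkhoffSum_forward (h : IsLindleyRecursion P U Θ V x b f) (n : ℕ) (ω : Ω) :
    birkhoffSum Θ (fun e => (x e : ℝ)) n (V ω) =
      ((∑ i ∈ Finset.range n, x (V (iter U i ω)) : ℤ) : ℝ) := by
  simp only [birkhoffSum, Int.cast_sum]
  refine Finset.sum_congr rfl fun i _ => ?_
  rw [map_iter h.factor_map, iter_natCast]

/-- Summing along the inverse map lists the increments at times `-1, …, -n`; in reversed order this
is the free walk started at time `-n` and read at time 0. -/
lemma birkhoffSum_backward (h : IsLindleyRecursion P U Θ V x b f) (n : ℕ) (ω : Ω) :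
    birkhoffSum Θ.symm (fun e => (x (Θ.symm e) : ℝ)) n (V ω) =
      ((∑ i ∈ Finset.range n, x (V (iter U i (iter U (-n) ω))) : ℤ) : ℝ) := by
  rw [← Finset.sum_range_reflect (fun i : ℕ => x (V (iter U i (iter U (-n) ω))))]
  simp only [birkhoffSum, Int.cast_sum]
  refine Finset.sum_congr rfl fun i hi => ?_
  rw [← iter_add, map_iter h.factor_map, ← Function.iterate_succ_apply' Θ.symm, ← iter_neg_natCast]
  have := Finset.mem_range.1 hi
  congr 3
  omega

lemma measurable_step_real (h : IsLindleyRecursion P U Θ V x b f) :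
    Measurable fun e => (x e : ℝ) :=
  (measurable_of_countable _).comp h.measurable_step

lemma stationary_recursion (h : IsLindleyRecursion P U Θ V x b f)
    (hZ : IsStationarySolution P U f Z) : ∀ᵐ ω ∂P, ∀ n : ℤ, (Z (iter U (n + 1) ω) : ℤ) =
      max (Z (iter U n ω) + x (V (iter U n ω))) (b (V (iter U n ω))) := by
  filter_upwards [hZ.2] with ω hω n
  rw [hω, h.recursion]

/-- The itinerary `e ↦ (G (Θ^n e))` intertwines `Θ` with the shift, and a factor of an ergodic
system is ergodic. -/
lemma isErgodicSequence (h : IsLindleyRecursion P U Θ V x b f) {G : E → ℕ} (hG : Measurable G) :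
    IsErgodicSequence P U (fun ω => G (V ω)) := by
  have hmeas : Measurable fun (e : E) (n : ℤ) => G (iter Θ n e) :=
    measurable_pi_lambda _ fun n =>
      hG.comp (measurePreserving_iter h.ergodic.toMeasurePreserving n).measurable
  have h1 : P.map (fun ω (n : ℤ) => G (V (iter U n ω))) =
      (P.map V).map fun (e : E) (n : ℤ) => G (iter Θ n e) := by
    rw [Measure.map_map hmeas h.measurable_factor]
    congr 1
    funext ω n
    simp only [Function.comp, map_iter h.factor_map]
  rw [IsErgodicSequence, h1]
  refine (MeasurePreserving.mk hmeas rfl).ergodic_of_ergodic_semiconj h.ergodic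
    measurable_shift fun e => ?_
  funext n
  simp only [shift, iter_add Θ n 1, iter_one]

variable [IsProbabilityMeasure P]

lemma isProbabilityMeasure_map (h : IsLindleyRecursion P U Θ V x b f) :
    IsProbabilityMeasure (P.map V) :=
  Measure.isProbabilityMeasure_map h.measurable_factor.aemeasurable

lemma ae_forward_le (h : IsLindleyRecursion P U Θ V x b f) {a : ℝ}
    (ha : ∫ e, (x e : ℝ) ∂(P.map V) < a) : ∀ᵐ ω ∂P, ∃ C : ℝ, ∀ n : ℕ,
      ((∑ i ∈ Finset.range n, x (V (iter U i ω)) : ℤ) : ℝ) ≤ n * a + C := by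
  have := h.isProbabilityMeasure_map
  filter_upwards [ae_of_ae_map h.measurable_factor.aemeasurable
    (birkhoffSum_le_affine h.ergodic h.measurable_step_real h.integrable_step ha)] with ω hω
  simpa only [h.birkhoffSum_forward] using hω

lemma ae_le_forward (h : IsLindleyRecursion P U Θ V x b f) {a : ℝ}
    (ha : a < ∫ e, (x e : ℝ) ∂(P.map V)) : ∀ᵐ ω ∂P, ∃ C : ℝ, ∀ n : ℕ,
      n * a - C ≤ ((∑ i ∈ Finset.range n, x (V (iter U i ω)) : ℤ) : ℝ) := by
  have := h.isProbabilityMeasure_map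
  have h1 := birkhoffSum_le_affine (f := fun e => -(x e : ℝ)) (a := -a) h.ergodic
    h.measurable_step_real.neg h.integrable_step.neg (by rw [integral_neg]; linarith)
  filter_upwards [ae_of_ae_map h.measurable_factor.aemeasurable h1] with ω ⟨C, hC⟩
  refine ⟨C, fun n => ?_⟩
  have h2 := hC n
  have h3 : birkhoffSum Θ (fun e => -(x e : ℝ)) n (V ω) =
      -birkhoffSum Θ (fun e => (x e : ℝ)) n (V ω) := by
    simp [birkhoffSum]
  rw [h3, h.birkhoffSum_forward] at h2
  linarith

lemma ae_backward_le (h : IsLindleyRecursion P U Θ V x b f) {a : ℝ}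
    (ha : ∫ e, (x e : ℝ) ∂(P.map V) < a) : ∀ᵐ ω ∂P, ∃ C : ℝ, ∀ n : ℕ,
      ((∑ i ∈ Finset.range n, x (V (iter U i (iter U (-n) ω))) : ℤ) : ℝ) ≤ n * a + C := by
  have := h.isProbabilityMeasure_map
  have hmp := h.ergodic.toMeasurePreserving
  have h1 := birkhoffSum_le_affine (f := fun e => (x (Θ.symm e) : ℝ)) (a := a) h.ergodic.symm
    (h.measurable_step_real.comp Θ.symm.measurable)
    ((hmp.symm Θ).integrable_comp_of_integrable h.integrable_step)
    (by rwa [integral_comp_symm hmp (fun e => (x e : ℝ))])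
  filter_upwards [ae_of_ae_map h.measurable_factor.aemeasurable h1] with ω hω
  simpa only [h.birkhoffSum_backward] using hω

/-- In the stable case the free random walk drifts to `-∞`. -/
lemma ae_eventually_add_sum_nonpos (h : IsLindleyRecursion P U Θ V x b f)
    (hneg : ∫ e, (x e : ℝ) ∂(P.map V) < 0) : ∀ᵐ ω ∂P, ∀ q : ℤ, ∀ᶠ n : ℕ in atTop,
      q + ∑ i ∈ Finset.range n, x (V (iter U i ω)) ≤ 0 := by
  obtain ⟨a, ha, ha0⟩ := exists_between hneg
  filter_upwards [h.ae_forward_le ha] with ω ⟨C, hC⟩ q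
  have h1 : Tendsto (fun n : ℕ => (n : ℝ) * -a) atTop atTop :=
    tendsto_natCast_atTop_atTop.atTop_mul_const (by linarith)
  filter_upwards [h1.eventually_ge_atTop (q + C)] with n hn
  have h2 := hC n
  have h3 : (q : ℝ) + ((∑ i ∈ Finset.range n, x (V (iter U i ω)) : ℤ) : ℝ) ≤ 0 := by linarith
  exact_mod_cast h3

/-- Stationary sequences that eventually agree are equal. -/
lemma ae_eq_of_eventually_eq (h : IsLindleyRecursion P U Θ V x b f) (hZ : Measurable Z)
    (hZ' : Measurable Z') (heq : ∀ᵐ ω ∂P, ∀ᶠ n : ℕ in atTop, Z (iter U n ω) = Z' (iter U n ω)) :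
    Z =ᵐ[P] Z' := by
  have hm : MeasurableSet {ω | Z ω ≠ Z' ω} := (measurableSet_eq_fun hZ hZ').compl
  have hmp := fun n : ℕ => measurePreserving_iter h.measurePreserving n
  -- The probability of disagreement at time `n` tends to 0, but by invariance it does not depend on
  -- `n`.
  have h1 : Tendsto (fun n : ℕ => P (iter U n ⁻¹' {ω | Z ω ≠ Z' ω})) atTop (𝓝 (P ∅)) := by
    refine tendsto_measure_of_ae_tendsto_indicator_of_isFiniteMeasure atTop .empty
      (fun n => (hmp n).measurable hm) ?_
    filter_upwards [heq] with ω hω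
    filter_upwards [hω] with n hn
    simpa using hn
  have h2 : ∀ n : ℕ, P (iter U n ⁻¹' {ω | Z ω ≠ Z' ω}) = P {ω | Z ω ≠ Z' ω} := fun n =>
    (hmp n).measure_preimage hm.nullMeasurableSet
  simp only [h2, measure_empty] at h1
  exact tendsto_nhds_unique tendsto_const_nhds h1

lemma eventually_eq_of_stationary (h : IsLindleyRecursion P U Θ V x b f)
    (hneg : ∫ e, (x e : ℝ) ∂(P.map V) < 0) (hZ : IsStationarySolution P U f Z)
    (hZ' : IsStationarySolution P U f Z') :
    ∀ᵐ ω ∂P, ∀ᶠ n : ℕ in atTop, Z (iter U n ω) = Z' (iter U n ω) := by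
  filter_upwards [h.ae_eventually_add_sum_nonpos hneg, h.stationary_recursion hZ,
    h.stationary_recursion hZ'] with ω h1 h2 h3
  filter_upwards [h1 (Z ω), h1 (Z' ω)] with n h4 h5
  exact eq_of_add_sum_nonpos (u := fun n => Z (iter U n ω)) (v := fun n => Z' (iter U n ω))
    (fun n => mod_cast h2 n) (fun n => mod_cast h3 n) h4 h5

lemma eventually_eq_orbitSize (h : IsLindleyRecursion P U Θ V x b f)
    (hneg : ∫ e, (x e : ℝ) ∂(P.map V) < 0) (hZ : IsStationarySolution P U f Z) :
    ∀ᵐ ω ∂P, ∀ᶠ n : ℕ in atTop, Z (iter U n ω) = orbitSize f Q₀ n ω := by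
  filter_upwards [h.ae_eventually_add_sum_nonpos hneg, h.stationary_recursion hZ] with ω h1 h2
  filter_upwards [h1 (Z ω), h1 (Q₀ ω)] with n h4 h5
  exact eq_of_add_sum_nonpos (u := fun n => Z (iter U n ω)) (v := fun n => orbitSize f Q₀ n ω)
    (fun n => mod_cast h2 n) (fun n => h.orbitSize_succ n ω) h4 h5

lemma ae_eq_of_isStationarySolution (h : IsLindleyRecursion P U Θ V x b f)
    (hneg : ∫ e, (x e : ℝ) ∂(P.map V) < 0) (hZ : IsStationarySolution P U f Z)
    (hZ' : IsStationarySolution P U f Z') : Z' =ᵐ[P] Z :=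
  h.ae_eq_of_eventually_eq hZ'.1 hZ.1 (h.eventually_eq_of_stationary hneg hZ' hZ)

/-- The coupling events have a union of full measure, so `Z'` eventually agrees along the orbit with
the queue, which eventually agrees with `Z`. -/
lemma ae_eq_of_couplingConvergent (h : IsLindleyRecursion P U Θ V x b f)
    (hneg : ∫ e, (x e : ℝ) ∂(P.map V) < 0) (hQ₀ : Measurable Q₀)
    (hZ : IsStationarySolution P U f Z) (hZ' : Measurable Z')
    (hc : CouplingConvergent P U (orbitSize f Q₀) Z') : Z' =ᵐ[P] Z := by
  refine h.ae_eq_of_eventually_eq hZ' hZ.1 ?_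
  have hm : ∀ n : ℕ, MeasurableSet {ω | ∀ k : ℕ, n ≤ k →
      orbitSize f Q₀ k ω = Z' (iter U k ω)} := fun n => by
    simp only [Set.ofPred_forall]
    exact .iInter fun k => .iInter fun _ => measurableSet_eq_fun (h.measurable_orbitSize hQ₀ k)
      (hZ'.comp (measurePreserving_iter h.measurePreserving k).measurable)
  have h1 : P (⋃ n : ℕ, {ω | ∀ k : ℕ, n ≤ k → orbitSize f Q₀ k ω = Z' (iter U k ω)}) = 1 :=
    le_antisymm prob_le_one
      (le_of_tendsto' hc fun n => measure_mono (Set.subset_iUnion_of_subset n subset_rfl))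
  have h2 := (mem_ae_iff_prob_eq_one (MeasurableSet.iUnion hm)).2 h1
  filter_upwards [h2, h.eventually_eq_orbitSize (Q₀ := Q₀) hneg hZ] with ω h3 h4
  obtain ⟨m, hm⟩ := Set.mem_iUnion.1 h3
  filter_upwards [h4, eventually_ge_atTop m] with n h5 h6
  rw [h5]
  exact (hm n h6).symm

lemma strongCouplingConvergent (h : IsLindleyRecursion P U Θ V x b f)
    (hneg : ∫ e, (x e : ℝ) ∂(P.map V) < 0) (hQ₀ : SublinearStart P U Q₀)
    (hZ : IsStationarySolution P U f Z) :
    StrongCouplingConvergent P U (orbitSize f Q₀) Z := by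
  obtain ⟨a, ha, ha0⟩ := exists_between hneg
  filter_upwards [h.ae_eventually_add_sum_nonpos hneg, h.ae_backward_le ha,
    h.stationary_recursion hZ, hQ₀] with ω h1 ⟨C, hC⟩ h2 h3
  -- the free random walks started at time `-k` are bounded at time `0`, uniformly in `k`
  obtain ⟨D, hD⟩ : ∃ D : ℤ, ∀ k : ℕ, Q₀ (iter U (-k) ω) +
      ∑ i ∈ Finset.range k, x (V (iter U i (iter U (-k) ω))) ≤ D := by
    have h4 : ∀ᶠ k : ℕ in atTop, Q₀ (iter U (-k) ω) +
        ∑ i ∈ Finset.range k, x (V (iter U i (iter U (-k) ω))) ≤ ⌈C⌉ := by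
      -- Eventually the start is below `-a * k`, which cancels the drift `k * a` of the backward
      -- walk and leaves only `C`.
      filter_upwards [h3.eventually_lt_const (show (0 : ℝ) < -a by linarith),
        eventually_gt_atTop 0] with k hk hk0
      have hk0' : (0 : ℝ) < k := Nat.cast_pos.2 hk0
      rw [div_lt_iff₀ hk0'] at hk
      have h5 := hC k
      have h6 : (Q₀ (iter U (-k) ω) : ℝ) +
          ((∑ i ∈ Finset.range k, x (V (iter U i (iter U (-k) ω))) : ℤ) : ℝ) ≤ (⌈C⌉ : ℝ) := by
        linarith [Int.le_ceil C]
      exact_mod_cast h6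
    obtain ⟨K, hK⟩ := eventually_atTop.1 h4
    obtain ⟨D, hD⟩ := ((Set.finite_Iio K).image fun k : ℕ => (Q₀ (iter U (-k) ω) : ℤ) +
        ∑ i ∈ Finset.range k, x (V (iter U i (iter U (-k) ω)))).bddAbove
    refine ⟨max D ⌈C⌉, fun k => ?_⟩
    rcases lt_or_ge k K with hkK | hkK
    · exact le_max_of_le_left (hD ⟨k, hkK, rfl⟩)
    · exact le_max_of_le_right (hK k hkK)
  -- This `n` depends on `D` and `Z ω` but not on `k`, so it bounds every coupling time at once.
  obtain ⟨n, hn1, hn2⟩ := ((h1 D).and (h1 (Z ω))).exists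
  refine lt_of_le_of_lt (iSup_le fun k => ?_) (EReal.coe_lt_top (n : ℝ))
  refine (iInf₂_le (n : ℤ) ⟨by omega, ?_⟩).trans (le_of_eq (by simp))
  -- both sequences, started at time `-k`, agree at time `n`
  have hsum : ∑ i ∈ Finset.range (k + n), x (V (iter U i (iter U (-k) ω))) =
      ∑ i ∈ Finset.range k, x (V (iter U i (iter U (-k) ω))) +
        ∑ i ∈ Finset.range n, x (V (iter U i ω)) := by
    rw [Finset.sum_range_add]
    congr 1
    refine Finset.sum_congr rfl fun i _ => ?_
    rw [← iter_add]
    congr 3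
    push_cast
    ring
  have hu : ∀ m : ℕ, (orbitSize f Q₀ (m + 1) (iter U (-k) ω) : ℤ) =
      max (orbitSize f Q₀ m (iter U (-k) ω) + x (V (iter U m (iter U (-k) ω))))
        (b (V (iter U m (iter U (-k) ω)))) := fun m => h.orbitSize_succ m _
  have hv : ∀ m : ℕ, (Z (iter U ((m + 1 : ℕ) : ℤ) (iter U (-k) ω)) : ℤ) =
      max (Z (iter U m (iter U (-k) ω)) + x (V (iter U m (iter U (-k) ω))))
        (b (V (iter U m (iter U (-k) ω)))) := fun m => by
    have := h2 (m + -k)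
    rw [iter_add U m (-k), show (m : ℤ) + -k + 1 = ((m + 1 : ℕ) : ℤ) + -k by push_cast; ring,
      iter_add U _ (-k)] at this
    exact this
  -- For the stationary solution the bound at time 0, uniform in `k`, is `Z ω` itself, since it
  -- dominates its free walk.
  have hZ0 : Z (iter U (-k) ω) + ∑ i ∈ Finset.range k, x (V (iter U i (iter U (-k) ω))) ≤
      (Z ω : ℤ) := by
    have := add_sum_le_of_recursion (u := fun m : ℕ => Z (iter U m (iter U (-k) ω))) hv k
    simpa [← iter_add] using this
  have hfin := eq_of_add_sum_nonpos (u := fun m => orbitSize f Q₀ m (iter U (-k) ω))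
    (v := fun m : ℕ => Z (iter U m (iter U (-k) ω))) (n := k + n) hu hv
    (by
      rw [hsum]
      have := hD k
      simp only [orbitSize]
      linarith)
    (by
      rw [hsum]
      simp only [Nat.cast_zero, iter_zero]
      linarith)
  have h7 : ((n : ℤ) + k).toNat = k + n := by omega
  have h8 : iter U ((k + n : ℕ) : ℤ) (iter U (-k) ω) = iter U n ω := by
    rw [← iter_add]
    congr 1
    push_cast
    ring
  rw [h7, hfin, h8]

/-- The solution is Loynes' limit evaluated on the driving factor, hence ergodic; invariance carries
the one-step identity to all integer times. -/
lemma exists_isStationarySolution (h : IsLindleyRecursion P U Θ V x b f)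
    (hneg : ∫ e, (x e : ℝ) ∂(P.map V) < 0) :
    ∃ Z : Ω → ℕ, IsStationarySolution P U f Z ∧ IsErgodicSequence P U Z := by
  have := h.isProbabilityMeasure_map
  have hG := measurable_loynesLimit (Θ := Θ) h.measurable_step h.measurable_floor
  refine ⟨fun ω => loynesLimit Θ x b (V ω), ⟨hG.comp h.measurable_factor, ?_⟩,
    h.isErgodicSequence hG⟩
  have h1 := ae_of_ae_map h.measurable_factor.aemeasurable (ae_loynesLimit_map h.ergodic
    h.measurable_step h.floor_nonneg h.floor_le h.integrable_step hneg)
  rw [ae_all_iff]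
  intro n
  filter_upwards [(measurePreserving_iter h.measurePreserving n).quasiMeasurePreserving.ae h1]
    with ω hω
  rw [← Int.natCast_inj, h.recursion, iter_add_one, h.factor_map, hω]

/-- In the unstable case the recursion tends to infinity. -/
lemma convergesToImproper (h : IsLindleyRecursion P U Θ V x b f)
    (hpos : 0 < ∫ e, (x e : ℝ) ∂(P.map V)) (hQ₀ : Measurable Q₀) :
    ConvergesToImproper P (orbitSize f Q₀) := by
  obtain ⟨a, ha0, ha⟩ := exists_between hpos
  have hmeas : ∀ n, Measurable fun ω (k : ℕ) => ((orbitSize f Q₀ (n + k) ω : ℝ) : EReal) :=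
    fun n => measurable_pi_lambda _ fun k =>
      (measurable_of_countable fun m : ℕ => ((m : ℝ) : EReal)).comp (h.measurable_orbitSize hQ₀ _)
  have hlim : ∀ᵐ ω ∂P, Tendsto
      (fun (n : ℕ) (k : ℕ) => ((orbitSize f Q₀ (n + k) ω : ℝ) : EReal)) atTop
        (𝓝 fun _ => (⊤ : EReal)) := by
    filter_upwards [h.ae_le_forward ha] with ω ⟨C, hC⟩
    have h1 : Tendsto (fun n => (orbitSize f Q₀ n ω : ℝ)) atTop atTop := by
      refine tendsto_atTop_mono (fun n => ?_) (tendsto_atTop_add_const_right _ (-C)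
        (tendsto_natCast_atTop_atTop.atTop_mul_const ha0))
      have h2 := add_sum_le_of_recursion (u := fun n => orbitSize f Q₀ n ω)
        (fun n => h.orbitSize_succ n ω) n
      have h3 : (orbitSize f Q₀ 0 ω : ℝ) +
          ((∑ i ∈ Finset.range n, x (V (iter U i ω)) : ℤ) : ℝ) ≤ (orbitSize f Q₀ n ω : ℝ) := by
        exact_mod_cast h2
      have h4 : (0 : ℝ) ≤ (orbitSize f Q₀ 0 ω : ℝ) := Nat.cast_nonneg _
      have h5 := hC n
      linarith
    refine tendsto_pi_nhds.2 fun k => ?_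
    exact EReal.tendsto_coe_nhds_top_iff.2 (h1.comp (tendsto_add_atTop_nat k))
  refine ⟨fun n => (hmeas n).aemeasurable, aemeasurable_const, ?_⟩
  -- Almost sure convergence gives convergence in distribution by dominated convergence for bounded
  -- continuous test functions.
  refine ProbabilityMeasure.tendsto_iff_forall_integral_tendsto.2 fun g => ?_
  simp only [ProbabilityMeasure.coe_mk]
  have hg : ∀ {μ : Measure (ℕ → EReal)}, AEStronglyMeasurable g μ :=
    g.continuous.measurable.aestronglyMeasurable
  rw [integral_map aemeasurable_const hg]
  simp_rw [integral_map (hmeas _).aemeasurable hg]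
  refine tendsto_integral_of_dominated_convergence (fun _ => ‖g‖)
    (fun n => (g.continuous.measurable.comp (hmeas n)).aestronglyMeasurable) (integrable_const _)
    (fun n => ae_of_all _ fun ω => g.norm_coe_le_norm _) ?_
  filter_upwards [hlim] with ω hω
  exact (g.continuous.tendsto _).comp hω

end IsLindleyRecursion

/-! ### Measurable evaluation of a counting path at a random time -/

section PathEvaluation

/-- Evaluation of a non-decreasing right-continuous path at `t`, in terms of its values at
rational times. -/
noncomputable def pathEval (N : ℝ≥0 → ℕ) (t : ℝ≥0) : ℕ :=
  ⨅ k : ℕ, N (⌈t * (k + 1)⌉₊ / (k + 1))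

/-- The sampling times decrease towards `t` up to rounding but never fall below it. Right continuity
of an integer-valued path makes some sample equal to `N t`, and monotonicity makes that the infimum.
-/
lemma pathEval_eq {N : ℝ≥0 → ℕ} (hmono : Monotone N)
    (hright : ∀ t, ContinuousWithinAt N (Set.Ici t) t) (t : ℝ≥0) : pathEval N t = N t := by
  have hle : ∀ k : ℕ, t ≤ ⌈t * (k + 1)⌉₊ / ((k : ℝ≥0) + 1) := fun k => by
    rw [le_div_iff₀ (by positivity)]
    exact Nat.le_ceil _
  have hlim : Tendsto (fun k : ℕ => (⌈t * (k + 1)⌉₊ / (k + 1) : ℝ≥0)) atTop (𝓝 t) := by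
    rw [← NNReal.tendsto_coe]
    have h1 := (tendsto_nat_ceil_mul_div_atTop (R := ℝ) t.2).comp
      (tendsto_atTop_add_const_right _ (1 : ℝ) (tendsto_natCast_atTop_atTop (R := ℝ)))
    refine h1.congr fun k => ?_
    have h2 : ⌈(t : ℝ) * ((k : ℝ) + 1)⌉₊ = ⌈t * ((k : ℝ≥0) + 1)⌉₊ := by
      rw [← NNReal.coe_natCast, ← NNReal.coe_one, ← NNReal.coe_add, ← NNReal.coe_mul]
      exact Nonneg.nat_ceil_coe (t * ((k : ℝ≥0) + 1))
    simp only [Function.comp]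
    push_cast
    rw [← h2]
    rfl
  refine le_antisymm ?_ (le_ciInf fun k => hmono (hle k))
  have h3 : Tendsto (fun k : ℕ => N (⌈t * (k + 1)⌉₊ / (k + 1))) atTop (𝓝 (N t)) :=
    (hright t).tendsto.comp (tendsto_nhdsWithin_iff.2 ⟨hlim, Eventually.of_forall hle⟩)
  rw [nhds_discrete, tendsto_pure] at h3
  obtain ⟨k, hk⟩ := h3.exists
  exact (ciInf_le' _ k).trans hk.le

/-- Evaluation of arbitrary paths is not jointly measurable for the product σ-algebra; `pathEval`
is, because it reads only countably many coordinates. -/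
lemma measurable_pathEval : Measurable fun p : ℝ≥0 × (ℝ≥0 → ℕ) => pathEval p.2 p.1 := by
  refine Measurable.iInf fun k => ?_
  have h1 : Measurable fun p : ℕ × (ℝ≥0 → ℕ) => p.2 (p.1 / (k + 1)) :=
    measurable_from_prod_countable_right fun j => measurable_pi_apply (j / (k + 1) : ℝ≥0)
  have h2 : Measurable fun p : ℝ≥0 × (ℝ≥0 → ℕ) => (⌈p.1 * ((k : ℝ≥0) + 1)⌉₊, p.2) :=
    (Nat.measurable_ceil.comp (measurable_fst.mul_const _)).prodMk measurable_snd
  exact h1.comp h2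

end PathEvaluation

/-! ### Poisson mean and exponential tail -/

section Distributions

lemma hasSum_mul_poissonMeasure (r : ℝ≥0) :
    HasSum (fun n : ℕ => Real.exp (-r) * r ^ n / n.factorial * n) r := by
  rw [← hasSum_nat_add_iff' 1]
  simp only [Finset.range_one, Finset.sum_singleton, Nat.cast_zero, mul_zero, sub_zero]
  have h := (hasSum_one_poissonMeasure r).mul_left (r : ℝ)
  rw [mul_one] at h
  refine h.congr_fun fun n => ?_
  rw [Nat.factorial_succ]
  push_cast
  field_simp
  ring

lemma lintegral_poissonMeasure (r : ℝ≥0) : ∫⁻ n, (n : ℝ≥0∞) ∂(poissonMeasure r) = r := by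
  rw [poissonMeasure, lintegral_sum_measure]
  simp only [lintegral_smul_measure, lintegral_dirac, smul_eq_mul]
  have h := hasSum_mul_poissonMeasure r
  have h0 : ∀ n : ℕ, 0 ≤ Real.exp (-r) * r ^ n / n.factorial * n := fun n => by positivity
  calc ∑' n : ℕ, ENNReal.ofReal (Real.exp (-r) * r ^ n / n.factorial) * (n : ℝ≥0∞)
      = ∑' n : ℕ, ENNReal.ofReal (Real.exp (-r) * r ^ n / n.factorial * n) :=
        tsum_congr fun n => by rw [ENNReal.ofReal_mul (by positivity), ENNReal.ofReal_natCast]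
    _ = ENNReal.ofReal r := by rw [← ENNReal.ofReal_tsum_of_nonneg h0 h.summable, h.tsum_eq]
    _ = r := ENNReal.ofReal_coe_nnreal

lemma expMeasure_Ioi {a : ℝ} (ha : 0 < a) {t : ℝ} (ht : 0 ≤ t) :
    expMeasure a (Set.Ioi t) = ENNReal.ofReal (Real.exp (-a * t)) := by
  have := isProbabilityMeasure_expMeasure ha
  have h1 : expMeasure a (Set.Iic t) = ENNReal.ofReal (1 - Real.exp (-(a * t))) := by
    rw [← ofReal_cdf, cdf_expMeasure_eq ha, if_pos ht]
  have h2 : Real.exp (-(a * t)) ≤ 1 := Real.exp_le_one_iff.2 (by nlinarith)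
  rw [← Set.compl_Iic, prob_compl_eq_one_sub measurableSet_Iic, h1, ← ENNReal.ofReal_one,
    ← ENNReal.ofReal_sub _ (by linarith)]
  congr 1
  rw [neg_mul]
  ring

end Distributions

/-! ### Stationarity and independence on sequence space -/

section Shift

variable {α : Type*} [MeasurableSpace α]

/-- The left shift as a measurable equivalence. -/
def shiftEquiv (α : Type*) [MeasurableSpace α] : (ℤ → α) ≃ᵐ (ℤ → α) where
  toFun := shift
  invFun x n := x (n - 1)
  left_inv x := by funext n; simp [shift]
  right_inv x := by funext n; simp [shift]
  measurable_toFun := measurable_shift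
  measurable_invFun := measurable_pi_lambda _ fun n => measurable_pi_apply (n - 1)

lemma apply_iter_of_shift {Ω β : Type*} [MeasurableSpace Ω] {U : Ω ≃ᵐ Ω} {g : ℤ → Ω → β}
    (hg : ∀ n ω, g n (U ω) = g (n + 1) ω) (n : ℤ) (ω : Ω) : g 0 (iter U n ω) = g n ω := by
  have key : ∀ m : ℤ, g m (iter U n ω) = g (m + n) ω := by
    induction n using Int.induction_on with
    | zero => simp
    | succ n ih =>
      intro m
      rw [iter_add_one, hg, ih]
      congr 1
      ring
    | pred n ih =>
      intro m
      have h1 : iter U (-(n : ℤ)) ω = U (iter U (-(n : ℤ) - 1) ω) := by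
        rw [← iter_add_one, sub_add_cancel]
      have h2 := ih (m - 1)
      rw [h1, hg, sub_add_cancel] at h2
      rw [h2]
      congr 1
      ring
  simpa using key 0

lemma map_comp_of_measurePreserving {Ω : Type*} [MeasurableSpace Ω] {P : Measure Ω} {U : Ω → Ω}
    (hU : MeasurePreserving U P P) {g : Ω → α} (hg : Measurable g) :
    P.map (fun ω => g (U ω)) = P.map g := by
  rw [← Function.comp_def, ← Measure.map_map hg hU.measurable, hU.map_eq]

lemma iIndepFun_map {Ω ι β : Type*} [MeasurableSpace Ω] [MeasurableSpace β] {P : Measure Ω}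
    {g : ι → Ω → β} (hg : ∀ i, Measurable (g i)) (h : iIndepFun g P) :
    iIndepFun (fun (i : ι) (y : ι → β) => y i) (P.map fun ω i => g i ω) := by
  have hm : Measurable fun ω i => g i ω := measurable_pi_lambda _ hg
  rw [iIndepFun_iff_measure_inter_preimage_eq_mul] at h ⊢
  intro S A hA
  have h1 : ∀ i ∈ S, MeasurableSet ((fun y : ι → β => y i) ⁻¹' A i) := fun i hi =>
    measurable_pi_apply i (hA i hi)
  rw [Measure.map_apply hm (Finset.measurableSet_biInter S h1)]
  refine Eq.trans ?_ ((h S hA).trans (Finset.prod_congr rfl fun i hi => ?_))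
  · simp only [Set.preimage_iInter]
    rfl
  · rw [Measure.map_apply hm (h1 i hi)]
    rfl

end Shift

/-! ### The queue as a Lindley recursion, and its drift -/

namespace ControlRetrialQueue

variable {Ω : Type*} [MeasurableSpace Ω] {P : Measure Ω} (M : ControlRetrialQueue P)

/-- The space of the retrial time, the residual arrival time and the arrivals in a cycle. -/
abbrev CycleSpace : Type := ℝ≥0 × ℝ × (ℝ≥0 → ℕ)

/-- The retrial time, the residual arrival time and the arrivals in the `n`-th cycle. -/
def cycle (n : ℤ) (ω : Ω) : CycleSpace := (M.r n ω, M.γ n ω, fun t => M.N n t ω)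

/-- All the driving sequences. -/
def driving (ω : Ω) : (ℤ → ℝ≥0) × (ℤ → CycleSpace) := (fun n => M.σ n ω, fun n => M.cycle n ω)

/-- The shift of the driving sequences. -/
def drivingShift : ((ℤ → ℝ≥0) × (ℤ → CycleSpace)) ≃ᵐ ((ℤ → ℝ≥0) × (ℤ → CycleSpace)) :=
  (shiftEquiv ℝ≥0).prodCongr (shiftEquiv CycleSpace)

/-- The number of arrivals during a service, as a function of the driving sequences. -/
noncomputable def arrivals (e : (ℤ → ℝ≥0) × (ℤ → CycleSpace)) : ℤ :=
  pathEval (e.2 0).2.2 (e.1 0)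

open Classical in
/-- The indicator that the retrial finishes first, as a function of the driving sequences. -/
noncomputable def retrialFirst (e : (ℤ → ℝ≥0) × (ℤ → CycleSpace)) : ℤ :=
  if ((e.2 0).1 : ℝ) < (e.2 0).2.1 then 1 else 0

lemma measurable_path (n : ℤ) : Measurable fun ω t => M.N n t ω :=
  measurable_pi_lambda _ fun t => (M.N_poisson n).measurable t

lemma measurable_cycle (n : ℤ) : Measurable (M.cycle n) :=
  (M.measurable_r n).prodMk ((M.measurable_γ n).prodMk (M.measurable_path n))

lemma measurable_services : Measurable fun ω n => M.σ n ω :=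
  measurable_pi_lambda _ M.measurable_σ

lemma measurable_cycles : Measurable fun ω n => M.cycle n ω :=
  measurable_pi_lambda _ M.measurable_cycle

lemma measurable_driving : Measurable M.driving :=
  M.measurable_services.prodMk M.measurable_cycles

lemma measurable_arrivals : Measurable arrivals := by
  have h : Measurable fun e : (ℤ → ℝ≥0) × (ℤ → CycleSpace) => (e.1 0, (e.2 0).2.2) :=
    ((measurable_pi_apply 0).comp measurable_fst).prodMk
      (measurable_snd.comp (measurable_snd.comp ((measurable_pi_apply 0).comp measurable_snd)))
  exact (measurable_of_countable (Nat.cast : ℕ → ℤ)).comp (measurable_pathEval.comp h)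

lemma measurable_retrialFirst : Measurable retrialFirst := by
  have h : Measurable fun e : (ℤ → ℝ≥0) × (ℤ → CycleSpace) => e.2 0 :=
    (measurable_pi_apply 0).comp measurable_snd
  refine Measurable.ite (measurableSet_lt ?_ ?_) measurable_const measurable_const
  · exact measurable_coe_nnreal_real.comp (measurable_fst.comp h)
  · exact measurable_fst.comp (measurable_snd.comp h)

lemma cycle_shift (n : ℤ) (ω : Ω) : M.cycle n (M.U ω) = M.cycle (n + 1) ω := by
  simp only [cycle, M.r_shift, M.γ_shift, M.N_shift]

lemma driving_map (ω : Ω) : M.driving (M.U ω) = drivingShift (M.driving ω) :=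
  Prod.ext (funext fun n => M.σ_shift n ω) (funext fun n => M.cycle_shift n ω)

lemma pathEval_apply (n : ℤ) (t : ℝ≥0) (ω : Ω) : pathEval (fun t => M.N n t ω) t = M.N n t ω :=
  pathEval_eq ((M.N_poisson n).mono ω) ((M.N_poisson n).rightCont ω) t

lemma arrivals_driving_iter (n : ℤ) (ω : Ω) :
    arrivals (M.driving (iter M.U n ω)) = M.N n (M.σ n ω) ω := by
  have h1 := apply_iter_of_shift M.σ_shift n ω
  have h2 := apply_iter_of_shift M.cycle_shift n ω
  simp only [arrivals, driving, h1, h2]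
  exact congrArg _ (M.pathEval_apply n _ ω)

open Classical in
lemma retrialFirst_driving_iter (n : ℤ) (ω : Ω) :
    retrialFirst (M.driving (iter M.U n ω)) = if (M.r n ω : ℝ) < M.γ n ω then 1 else 0 := by
  have h2 := apply_iter_of_shift M.cycle_shift n ω
  simp only [retrialFirst, driving, h2]
  rfl

lemma recursionStep_cast (n : ℤ) (q : ℕ) (ω : Ω) : (M.recursionStep n q ω : ℤ) =
    max (q + (arrivals (M.driving (iter M.U n ω)) - retrialFirst (M.driving (iter M.U n ω)))) 0 := by
  rw [arrivals_driving_iter, retrialFirst_driving_iter]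
  exact Int.toNat_eq_max _

/-- The floor matters only when the orbit is empty and the retrial finishes first: nobody leaves,
and the new orbit consists of the arrivals alone. -/
lemma queueStep_cast (n : ℤ) (q : ℕ) (ω : Ω) : (M.queueStep n q ω : ℤ) =
    max (q + (arrivals (M.driving (iter M.U n ω)) - retrialFirst (M.driving (iter M.U n ω))))
      (arrivals (M.driving (iter M.U n ω))) := by
  rw [arrivals_driving_iter, retrialFirst_driving_iter]
  unfold queueStep
  by_cases h : (M.r n ω : ℝ) < M.γ n ω
  · simp only [h, and_true, if_true]
    split_ifs <;> omega
  · simp only [h, and_false, if_false]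
    omega

lemma integral_σ_zero : ∫ ω, (M.σ 0 ω : ℝ) ∂P = M.meanService := by
  rw [meanService, ← M.measurePreserving.integral_comp' (fun ω => (M.σ 0 ω : ℝ))]
  simp only [M.σ_shift, zero_add]

lemma integrable_σ_zero : Integrable (fun ω => (M.σ 0 ω : ℝ)) P := by
  rw [← M.measurePreserving.integrable_comp_emb M.U.measurableEmbedding]
  simpa only [Function.comp_def, M.σ_shift, zero_add] using M.σ_integrable

lemma arrivals_driving (ω : Ω) : arrivals (M.driving ω) = M.N 0 (M.σ 0 ω) ω :=
  M.arrivals_driving_iter 0 ω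

lemma measurable_arrivals_driving : Measurable fun ω => (arrivals (M.driving ω) : ℝ) :=
  (measurable_of_countable (Int.cast : ℤ → ℝ)).comp (measurable_arrivals.comp M.measurable_driving)

lemma retrialFirst_driving (ω : Ω) : (retrialFirst (M.driving ω) : ℝ) =
    {ω | (M.r 0 ω : ℝ) < M.γ 0 ω}.indicator (fun _ => (1 : ℝ)) ω := by
  have h := M.retrialFirst_driving_iter 0 ω
  rw [iter_zero] at h
  rw [h, Set.indicator_apply]
  simp only [Set.mem_ofPred_eq]
  split_ifs <;> simp

lemma measurableSet_retrial_lt : MeasurableSet {ω | (M.r 0 ω : ℝ) < M.γ 0 ω} :=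
  measurableSet_lt (measurable_coe_nnreal_real.comp (M.measurable_r 0)) (M.measurable_γ 0)

lemma lintegral_N (n : ℤ) (t : ℝ≥0) : ∫⁻ ω, (M.N n t ω : ℝ≥0∞) ∂P = M.lam * t := by
  have hN := M.N_poisson n
  have h1 := hN.law_increments 0 t zero_le
  simp only [hN.zero, tsub_zero] at h1
  have h2 := lintegral_poissonMeasure (M.lam * t)
  rw [← h1, lintegral_map (measurable_of_countable _) (hN.measurable t)] at h2
  simpa using h2

variable [IsProbabilityMeasure P]

/-- Independence of services and cycles makes the joint law a product; the cycles are stationary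
through `U` and independent, so their shift is Bernoulli. -/
lemma ergodic_drivingShift : Ergodic drivingShift (P.map M.driving) := by
  have hp1 := Measure.isProbabilityMeasure_map (μ := P) M.measurable_services.aemeasurable
  have hp2 := Measure.isProbabilityMeasure_map (μ := P) M.measurable_cycles.aemeasurable
  have h1 : P.map M.driving =
      (P.map fun ω n => M.σ n ω).prod (P.map fun ω n => M.cycle n ω) :=
    (indepFun_iff_map_prod_eq_prod_map_map M.measurable_services.aemeasurable
      M.measurable_cycles.aemeasurable).1 M.indep_services
  have h2 : MeasurePreserving shift (P.map fun ω n => M.cycle n ω)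
      (P.map fun ω n => M.cycle n ω) := by
    refine ⟨measurable_shift, ?_⟩
    rw [Measure.map_map measurable_shift M.measurable_cycles]
    rw [← map_comp_of_measurePreserving M.measurePreserving M.measurable_cycles]
    congr 1
    funext ω n
    exact (M.cycle_shift n ω).symm
  rw [h1]
  exact ergodic_prodMap_shift M.σ_ergodic h2 (iIndepFun_map M.measurable_cycle M.indep_cycles)

/-- The service time is independent of the arrival path, so Fubini allows it to be frozen at `t`,
where the Poisson mean is `λ t`. -/
lemma lintegral_arrivals :
    ∫⁻ ω, (M.N 0 (M.σ 0 ω) ω : ℝ≥0∞) ∂P = M.lam * ∫⁻ ω, (M.σ 0 ω : ℝ≥0∞) ∂P := by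
  have hind : IndepFun (M.σ 0) (fun ω t => M.N 0 t ω) P :=
    M.indep_services.comp (measurable_pi_apply 0)
      (measurable_snd.comp (measurable_snd.comp (measurable_pi_apply 0)))
  have h1 := (indepFun_iff_map_prod_eq_prod_map_map (M.measurable_σ 0).aemeasurable
    (M.measurable_path 0).aemeasurable).1 hind
  have hp := Measure.isProbabilityMeasure_map (μ := P) (M.measurable_path 0).aemeasurable
  have hm : Measurable fun p : ℝ≥0 × (ℝ≥0 → ℕ) => (pathEval p.2 p.1 : ℝ≥0∞) :=
    (measurable_of_countable _).comp measurable_pathEval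
  calc ∫⁻ ω, (M.N 0 (M.σ 0 ω) ω : ℝ≥0∞) ∂P
      = ∫⁻ p, (pathEval p.2 p.1 : ℝ≥0∞) ∂(P.map fun ω => (M.σ 0 ω, fun t => M.N 0 t ω)) := by
        rw [lintegral_map hm ((M.measurable_σ 0).prodMk (M.measurable_path 0))]
        simp only [M.pathEval_apply]
    _ = ∫⁻ t, ∫⁻ N, (pathEval N t : ℝ≥0∞) ∂(P.map fun ω t => M.N 0 t ω) ∂(P.map (M.σ 0)) := by
        rw [h1, lintegral_prod _ hm.aemeasurable]
    _ = ∫⁻ t, (M.lam * t : ℝ≥0∞) ∂(P.map (M.σ 0)) := by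
        refine lintegral_congr fun t => ?_
        refine (lintegral_map (hm.comp measurable_prodMk_left) (M.measurable_path 0)).trans ?_
        simp only [Function.comp, M.pathEval_apply, M.lintegral_N 0 t]
    _ = M.lam * ∫⁻ ω, (M.σ 0 ω : ℝ≥0∞) ∂P := by
        rw [lintegral_const_mul _ measurable_coe_nnreal_ennreal,
          lintegral_map measurable_coe_nnreal_ennreal (M.measurable_σ 0)]

lemma lintegral_ofReal_arrivals :
    ∫⁻ ω, ENNReal.ofReal (arrivals (M.driving ω) : ℝ) ∂P =
      ENNReal.ofReal (M.lam * M.meanService) := by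
  have h1 : ∫⁻ ω, (M.σ 0 ω : ℝ≥0∞) ∂P = ENNReal.ofReal M.meanService := by
    rw [← M.integral_σ_zero, ofReal_integral_eq_lintegral_ofReal M.integrable_σ_zero
      (ae_of_all _ fun ω => NNReal.coe_nonneg _)]
    simp only [ENNReal.ofReal_coe_nnreal]
  have h2 := M.lintegral_arrivals
  rw [h1] at h2
  rw [ENNReal.ofReal_mul (NNReal.coe_nonneg _), ENNReal.ofReal_coe_nnreal, ← h2]
  refine lintegral_congr fun ω => ?_
  rw [M.arrivals_driving, Int.cast_natCast, ENNReal.ofReal_natCast]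

lemma arrivals_nonneg (e : (ℤ → ℝ≥0) × (ℤ → CycleSpace)) : 0 ≤ arrivals e :=
  Int.natCast_nonneg _

lemma integrable_arrivals : Integrable (fun ω => (arrivals (M.driving ω) : ℝ)) P := by
  refine ⟨M.measurable_arrivals_driving.aestronglyMeasurable, ?_⟩
  rw [hasFiniteIntegral_iff_ofReal (ae_of_all _ fun ω => Int.cast_nonneg (arrivals_nonneg _)),
    M.lintegral_ofReal_arrivals]
  exact ENNReal.ofReal_lt_top

lemma integral_arrivals : ∫ ω, (arrivals (M.driving ω) : ℝ) ∂P = M.lam * M.meanService := by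
  rw [integral_eq_lintegral_of_nonneg_ae
    (ae_of_all _ fun ω => Int.cast_nonneg (arrivals_nonneg _))
    M.measurable_arrivals_driving.aestronglyMeasurable, M.lintegral_ofReal_arrivals,
    ENNReal.toReal_ofReal]
  exact mul_nonneg (NNReal.coe_nonneg _) (integral_nonneg fun ω => NNReal.coe_nonneg _)

/-- Given `r = t`, the exponential variable `γ` exceeds `t` with probability `e^{-λ t}`; averaging
over `r` gives the Laplace transform. -/
lemma measureReal_retrial_lt : P.real {ω | (M.r 0 ω : ℝ) < M.γ 0 ω} = M.rStar M.lam := by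
  have hp := isProbabilityMeasure_expMeasure (r := (M.lam : ℝ)) M.lam_pos
  have h1 := (indepFun_iff_map_prod_eq_prod_map_map (M.measurable_r 0).aemeasurable
    (M.measurable_γ 0).aemeasurable).1 (M.indep_r_γ 0)
  rw [M.γ_law] at h1
  have hm : MeasurableSet {p : ℝ≥0 × ℝ | (p.1 : ℝ) < p.2} :=
    measurableSet_lt (measurable_coe_nnreal_real.comp measurable_fst) measurable_snd
  have h2 : P {ω | (M.r 0 ω : ℝ) < M.γ 0 ω} =
      ∫⁻ t, ENNReal.ofReal (Real.exp (-M.lam * (t : ℝ))) ∂(P.map (M.r 0)) := by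
    calc P {ω | (M.r 0 ω : ℝ) < M.γ 0 ω}
        = P.map (fun ω => (M.r 0 ω, M.γ 0 ω)) {p : ℝ≥0 × ℝ | (p.1 : ℝ) < p.2} :=
          (Measure.map_apply ((M.measurable_r 0).prodMk (M.measurable_γ 0)) hm).symm
      _ = _ := by
          rw [h1, Measure.prod_apply hm]
          exact lintegral_congr fun t => expMeasure_Ioi M.lam_pos (NNReal.coe_nonneg t)
  have h3 : P.map (M.r 1) = P.map (M.r 0) := by
    rw [← map_comp_of_measurePreserving M.measurePreserving (M.measurable_r 0)]
    simp only [M.r_shift, zero_add]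
  rw [measureReal_def, h2, rStar, laplaceTransform, h3, integral_eq_lintegral_of_nonneg_ae
    (ae_of_all _ fun t => (Real.exp_pos _).le)]
  exact (Real.measurable_exp.comp
    (measurable_coe_nnreal_real.const_mul _)).aestronglyMeasurable

lemma integrable_retrialFirst : Integrable (fun ω => (retrialFirst (M.driving ω) : ℝ)) P := by
  simp only [M.retrialFirst_driving]
  exact (integrable_const 1).indicator M.measurableSet_retrial_lt

lemma integral_retrialFirst : ∫ ω, (retrialFirst (M.driving ω) : ℝ) ∂P = M.rStar M.lam := by
  simp only [M.retrialFirst_driving]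
  rw [integral_indicator_const _ M.measurableSet_retrial_lt, smul_eq_mul, mul_one,
    M.measureReal_retrial_lt]

lemma measurable_increment : Measurable fun e => arrivals e - retrialFirst e :=
  measurable_arrivals.sub measurable_retrialFirst

lemma aestronglyMeasurable_increment {μ : Measure ((ℤ → ℝ≥0) × (ℤ → CycleSpace))} :
    AEStronglyMeasurable (fun e => ((arrivals e - retrialFirst e : ℤ) : ℝ)) μ :=
  ((measurable_of_countable (Int.cast : ℤ → ℝ)).comp measurable_increment).aestronglyMeasurable

lemma integrable_increment :
    Integrable (fun e => ((arrivals e - retrialFirst e : ℤ) : ℝ)) (P.map M.driving) := by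
  rw [integrable_map_measure aestronglyMeasurable_increment M.measurable_driving.aemeasurable]
  simp only [Function.comp_def, Int.cast_sub]
  exact M.integrable_arrivals.sub M.integrable_retrialFirst

lemma integral_increment :
    ∫ e, ((arrivals e - retrialFirst e : ℤ) : ℝ) ∂(P.map M.driving) =
      M.lam * M.meanService - M.rStar M.lam := by
  rw [integral_map M.measurable_driving.aemeasurable aestronglyMeasurable_increment]
  simp only [Int.cast_sub]
  rw [integral_sub M.integrable_arrivals M.integrable_retrialFirst, M.integral_arrivals,
    M.integral_retrialFirst]

lemma retrialFirst_le_one (e : (ℤ → ℝ≥0) × (ℤ → CycleSpace)) : retrialFirst e ≤ 1 := by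
  unfold retrialFirst
  split_ifs <;> norm_num

/-- Both recursions for the orbit size are of the form `q ↦ max (q + ξ_n) b_n`. -/
theorem exists_isLindleyRecursion {f : ℤ → ℕ → Ω → ℕ}
    (hf : f = M.recursionStep ∨ f = M.queueStep) :
    ∃ b, IsLindleyRecursion P M.U drivingShift M.driving
      (fun e => arrivals e - retrialFirst e) b f := by
  rcases hf with rfl | rfl
  · exact ⟨fun _ => 0, M.measurePreserving, M.measurable_driving, M.driving_map,
      M.ergodic_drivingShift, measurable_increment, measurable_const, fun e => le_rfl,
      fun e => le_max_left _ _, M.integrable_increment, M.recursionStep_cast⟩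
  · refine ⟨arrivals, M.measurePreserving, M.measurable_driving, M.driving_map,
      M.ergodic_drivingShift, measurable_increment, measurable_arrivals, arrivals_nonneg,
      fun e => le_max_of_le_right ?_, M.integrable_increment, M.queueStep_cast⟩
    have := retrialFirst_le_one e
    omega

end ControlRetrialQueue

end RetrialQueue

open RetrialQueue in
theorem theorem3 {Ω : Type*} [MeasurableSpace Ω] (P : Measure Ω) [IsProbabilityMeasure P]
    (M : ControlRetrialQueue P) (f : ℤ → ℕ → Ω → ℕ)
    (hf : f = M.recursionStep ∨ f = M.queueStep)
    (Q₀ : Ω → ℕ) (hQ₀ : Measurable Q₀) :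
    ((M.lam : ℝ) * M.meanService < M.rStar M.lam → SublinearStart P M.U Q₀ →
      ∃ Z : Ω → ℕ, IsStationarySolution P M.U f Z ∧ IsErgodicSequence P M.U Z ∧
        StrongCouplingConvergent P M.U (orbitSize f Q₀) Z ∧
        (∀ Z' : Ω → ℕ, IsStationarySolution P M.U f Z' → Z' =ᵐ[P] Z) ∧
        (∀ Z' : Ω → ℕ, Measurable Z' →
          CouplingConvergent P M.U (orbitSize f Q₀) Z' → Z' =ᵐ[P] Z)) ∧
    (M.rStar M.lam < (M.lam : ℝ) * M.meanService →
      ConvergesToImproper P (orbitSize f Q₀)) := by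
  obtain ⟨b, h⟩ := M.exists_isLindleyRecursion hf
  refine ⟨fun hlt hsub => ?_, fun hlt => h.convergesToImproper ?_ hQ₀⟩
  · have hneg := M.integral_increment.trans_lt (sub_neg.2 hlt)
    obtain ⟨Z, hZ, hZerg⟩ := h.exists_isStationarySolution hneg
    exact ⟨Z, hZ, hZerg, h.strongCouplingConvergent hneg hsub hZ,
      fun Z' hZ' => h.ae_eq_of_isStationarySolution hneg hZ hZ',
      fun Z' hZ' hc => h.ae_eq_of_couplingConvergent hneg hQ₀ hZ hZ' hc⟩
  · exact (sub_pos.2 hlt).trans_eq M.integral_increment.symm
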